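/- Let $G_{\rm phys}=(V,E,F_{\rm int})$ be a planar patch, i.e. a finite cellulation of a closed disk, and let $G=(V,E,F)$, $F=F_{\rm int}\cup\{f_\infty\}$, be the cellulation of the sphere obtained by adding the exterior as one extra face. Let $D:\mathbb F_2^E\to\mathbb F_2^V$ and $B:\mathbb F_2^F\to\mathbb F_2^E$ be the mod-2 edge–vertex and face–edge incidence (boundary) maps of $G$, and put $\langle w,c\rangle=\sum_{e\in E}w_ec_e\in\mathbb F_2$. Let $(c_\alpha)_{\alpha\in\mathcal I}$ be simple paths along edges of $G$ (each with at least one edge and without repeated vertices), with pairwise disjoint edge sets, identified with their indicator vectors in $\mathbb F_2^E$. Let $u_\alpha,v_\alpha$ be the endpoints of $c_\alpha$, and let $\Gamma_{\rm end}$ be the multigraph whose vertices are all these endpoints and which has, for each $\alpha\in\mathcal I$, one edge joining $u_\alpha$ and $v_\alpha$. A simple closed dual loop is a simple closed curve on the sphere that avoids the vertices of $G$ and meets the edges of $G$ in finitely many points, at least one, at each of which it crosses the edge from one side to the other. (It may cross an edge or visit a face several times.) Its cochain $w\in\mathbb F_2^E$ records for each edge the parity of the number of crossings. Then the following are equivalent: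 (a) $\Gamma_{\rm end}$ is bipartite; (a') every cycle of $\Gamma_{\rm end}$ has even length; (b) there is no finite subset $\mathcal A\subseteq\mathcal I$ with $|\mathcal A|$ odd and $D\bigl(\bigoplus_{\alpha\in\mathcal A}c_\alpha\bigr)=0$; (c) there is a simple closed dual loop whose cochain $w$ satisfies $\langle w,c_\alpha\rangle=1$ for all $\alpha\in\mathcal I$, i.e. that crosses every $c_\alpha$ an odd number of times; (i) there is a cochain $w\in\mathbb F_2^E$ with $B^{\top}w=0$ and $\langle w,c_\alpha\rangle=1$ for all $\alpha\in\mathcal I$. -/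

import Mathlib

universe u

/-- A closed oriented surface cut into finitely many polygons. The polygon of a face `f` is the
closed unit disk whose boundary circle is divided counterclockwise into `deg f ≥ 1` sides
`(f, 0), …, (f, deg f - 1)`, and the sides of all polygons are glued in pairs, reversing their
direction. -/
structure PolygonGluing where
  Face : Type u
  finite_face : Finite Face
  deg : Face → ℕ
  deg_pos : ∀ f, 0 < deg f
  glue : Equiv.Perm (Σ f, Fin (deg f))
  glue_glue : ∀ d, glue (glue d) = d
  glue_ne : ∀ d, glue d ≠ d

namespace PolygonGluing

attribute [instance] PolygonGluing.finite_face

variable (P : PolygonGluing.{u})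

/-- The sides of the polygons. A side is also a directed primal edge: the edge it is glued into,
with the direction in which the boundary of its polygon runs. -/
abbrev Side : Type u := Σ f : P.Face, Fin (P.deg f)

/-- The side that follows a given one on the boundary of the same polygon. -/
def next : Equiv.Perm P.Side := Equiv.sigmaCongrRight fun f => finRotate (P.deg f)

/-- The side `glue d` runs back along `d`, so the side after it starts at the vertex at which `d`
starts: this permutation turns once around that vertex. -/
def turn : Equiv.Perm P.Side := P.glue.trans P.next

/-- A vertex is given by the sides that start at it, a cycle of `turn`. -/
def Vertex : Type u := Quotient (Equiv.Perm.SameCycle.setoid P.turn)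

/-- An (undirected) edge is a pair `{d, glue d}` of sides, a cycle of `glue`. -/
def Edge : Type u := Quotient (Equiv.Perm.SameCycle.setoid P.glue)

variable {P}

/-- The vertex at which a side starts. -/
def tail (d : P.Side) : P.Vertex := Quotient.mk _ d

/-- The vertex at which a side ends. -/
def head (d : P.Side) : P.Vertex := tail (P.glue d)

/-- The edge on which a side lies. -/
def edge (d : P.Side) : P.Edge := Quotient.mk _ d

noncomputable section

instance : Fintype P.Face := Fintype.ofFinite _

instance : Finite P.Vertex := inferInstanceAs (Finite (Quotient _))

instance : Finite P.Edge := inferInstanceAs (Finite (Quotient _))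

instance : Fintype P.Vertex := Fintype.ofFinite _

instance : Fintype P.Edge := Fintype.ofFinite _

variable (P)

/-- The edge–vertex incidence matrix `D = ∂₁` over `𝔽₂`: the number, mod 2, of ends of `e`
at `v`. -/
def D : Matrix P.Vertex P.Edge (ZMod 2) :=
  fun v e => (({d : P.Side | edge d = e ∧ tail d = v}.ncard : ℕ) : ZMod 2)

/-- The face–edge incidence matrix `B = ∂₂` over `𝔽₂`: the number, mod 2, of times the boundary
of the polygon `f` runs along `e`. -/
def B : Matrix P.Edge P.Face (ZMod 2) :=
  fun e f => (({d : P.Side | edge d = e ∧ d.1 = f}.ncard : ℕ) : ZMod 2)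

variable {P}

/-- The point at parameter `s ∈ [0, 1]` of a side, on the unit circle that bounds its polygon.
In the surface it is identified with the point `1 - s` of the side `glue d`. -/
def sidePoint (d : P.Side) (s : ℝ) : ℂ :=
  Complex.exp (2 * Real.pi * (((d.2 : ℕ) : ℝ) + s) / (P.deg d.1 : ℝ) * Complex.I)

end

end PolygonGluing

/-- A planar patch, a finite cellulation of the closed disk, given through the cellulation of the
sphere that results from adding the exterior as one more face `outer`. The surface is a sphere:
it is connected with Euler characteristic `2`. Its part outside the open face `outer` is a closed
disk: the boundary of `outer` is a simple closed edge path. -/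
structure PlanarPatch extends PolygonGluing.{u} where
  connected : ∀ d d' : toPolygonGluing.Side,
    Relation.ReflTransGen (fun a b => b = glue a ∨ b = toPolygonGluing.next a) d d'
  euler : (Nat.card toPolygonGluing.Vertex : ℤ) - Nat.card toPolygonGluing.Edge + Nat.card Face = 2
  outer : Face
  outer_simple : Function.Injective
    fun j : Fin (deg outer) => PolygonGluing.tail (P := toPolygonGluing) ⟨outer, j⟩
  outer_glue : ∀ j : Fin (deg outer), (glue ⟨outer, j⟩).1 ≠ outer

namespace PlanarPatch

open PolygonGluing

variable {P : PlanarPatch.{u}}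

/-- A simple primal path: it runs along `len ≥ 1` directed edges and visits no vertex twice. -/
structure PrimalPath (P : PlanarPatch.{u}) where
  len : ℕ
  len_pos : 0 < len
  vert : Fin (len + 1) → P.Vertex
  side : Fin len → P.Side
  tail_side : ∀ i, tail (side i) = vert i.castSucc
  head_side : ∀ i, head (side i) = vert i.succ
  vert_injective : Function.Injective vert

namespace PrimalPath

/-- The two endpoints `u` and `v`. -/
def source (c : PrimalPath P) : P.Vertex := c.vert 0

def target (c : PrimalPath P) : P.Vertex := c.vert (Fin.last c.len)

/-- The set of edges of the path. -/
def support (c : PrimalPath P) : Set P.Edge := Set.range fun i => edge (c.side i)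

/-- The path as a 1-chain over `𝔽₂`. -/
noncomputable def chain (c : PrimalPath P) : P.Edge → ZMod 2 := c.support.indicator 1

end PrimalPath

/-- The endpoint multigraph of a family of paths: its vertices are the endpoints of the paths, and
each path gives one edge between its two endpoints. -/
def endpointGraph {ι : Type*} (c : ι → PrimalPath P) : Graph P.Vertex ι where
  vertexSet := {x | ∃ a, x = (c a).source ∨ x = (c a).target}
  IsLink a x y := (x = (c a).source ∧ y = (c a).target) ∨ (x = (c a).target ∧ y = (c a).source)
  isLink_symm := fun _ _ => ⟨fun _ _ h => h.elim (fun h => .inr ⟨h.2, h.1⟩) fun h => .inl ⟨h.2, h.1⟩⟩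
  eq_or_eq_of_isLink_of_isLink := by
    rintro a x y v w (⟨rfl, rfl⟩ | ⟨rfl, rfl⟩) (⟨rfl, rfl⟩ | ⟨rfl, rfl⟩) <;> simp
  left_mem_of_isLink := fun a _ _ h => ⟨a, h.imp And.left And.left⟩

/-- A simple closed dual loop: a simple closed curve on the sphere that avoids the primal vertices
and meets the primal edges in finitely many points (at least one), crossing the edge from one
side to the other at each of them. It is given by its pieces between consecutive crossings.

The crossings are indexed cyclically by `Fin (m + 1)`. At the `i`-th crossing the curve leaves a
polygon at the point `pos i` of `side i` and enters, at the same point of the surface, the polygon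
on the other side. From there `arc i` leads through the open polygon to crossing `i + 1`. The curve
is simple: each arc is injective, and different arcs in the same polygon are disjoint. -/
structure SimpleDualLoop (P : PlanarPatch.{u}) where
  m : ℕ
  side : Fin (m + 1) → P.Side
  pos : Fin (m + 1) → ℝ
  pos_mem : ∀ i, pos i ∈ Set.Ioo (0 : ℝ) 1
  same_face : ∀ i, (P.glue (side i)).1 = (side (i + 1)).1
  arc : Fin (m + 1) → C(unitInterval, ℂ)
  arc_zero : ∀ i, arc i 0 = sidePoint (P.glue (side i)) (1 - pos i)
  arc_one : ∀ i, arc i 1 = sidePoint (side (i + 1)) (pos (i + 1))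
  arc_interior : ∀ i t, t ≠ 0 → t ≠ 1 → ‖arc i t‖ < 1
  arc_injective : ∀ i, Function.Injective (arc i)
  arc_disjoint : ∀ i j, i ≠ j → (P.glue (side i)).1 = (P.glue (side j)).1 →
    Disjoint (Set.range (arc i)) (Set.range (arc j))

/-- The 1-cochain of a dual loop: the number of its crossings with each edge, mod 2. -/
noncomputable def SimpleDualLoop.cochain (w : SimpleDualLoop P) : P.Edge → ZMod 2 :=
  fun e => (({i | edge (w.side i) = e}.ncard : ℕ) : ZMod 2)

end PlanarPatch

/-- A multigraph is bipartite if its vertices split into two classes such that every edge joins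
one class to the other. -/
def Graph.Bipartite {α β : Type*} (G : Graph α β) : Prop :=
  ∃ U₀ U₁ : Set α, Disjoint U₀ U₁ ∧ U₀ ∪ U₁ = G.vertexSet ∧
    ∀ e x y, G.IsLink e x y → (x ∈ U₀ ∧ y ∈ U₁) ∨ (x ∈ U₁ ∧ y ∈ U₀)

/-- The multigraph has a cycle of length `k + 1`: cyclically arranged distinct vertices, with
distinct edges joining consecutive ones (a loop if `k = 0`, two parallel edges if `k = 1`). -/
def Graph.HasCycle {α β : Type*} (G : Graph α β) (k : ℕ) : Prop :=
  ∃ (x : Fin (k + 1) → α) (e : Fin (k + 1) → β), Function.Injective x ∧ Function.Injective e ∧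
    ∀ i, G.IsLink (e i) (x i) (x (i + 1))

/-! All conditions are compared with the existence of a potential `x : P.Vertex → ZMod 2` whose
values at the two ends of each path add up to 1, which is a two-colouring of the endpoint graph. If
no potential exists, linear duality over 𝔽₂ yields an odd subfamily whose chains have total boundary
zero (`exists_potential_of_not_exists_odd`). Such a subfamily is incompatible with a cocycle `w` as
in (i): on the sphere a chain without boundary is a sum of face boundaries
(`exists_mulVec_B_of_mulVec_D_eq_zero`), so `w` pairs to 0 with it, while an odd number of ones adds
up to 1.

The geometric content is (a) ⇒ (c). The coboundary of a potential pairs to 1 with every path by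
telescoping, so it suffices that every coboundary is the cochain of one single simple closed curve.
The coboundary of a vertex is the cochain of a small circle around it; the difficulty is to merge
such circles into one curve. A loop that crosses an edge at `v` can be modified at its crossing
nearest to `v`: after it, the loop follows the edge towards `v`, runs once around `v` and resumes
its old course (`encircle_of_nearest`). This keeps it simple and adds exactly the coboundary of `v`.
Two such detours cancel mod 2 but leave all edges at `v` crossed; so a bigon with zero cochain
spreads over the connected surface until every edge is crossed, and then any chosen set of vertices
can be encircled.

Curves are handled combinatorially, as cyclic lists of crossings whose chords do not interlace in
any polygon; at the end the chords are drawn as straight segments in the unit disk. -/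

namespace Graph

/-! ### Bipartite multigraphs and odd cycles. -/

variable {α β : Type*} {G : Graph α β}

theorem Bipartite.even_of_hasCycle (h : G.Bipartite) {k : ℕ} (hc : G.HasCycle k) :
    Even (k + 1) := by
  classical
  obtain ⟨U₀, U₁, hd, -, hl⟩ := h
  obtain ⟨x, e, -, -, hxe⟩ := hc
  have step : ∀ i, (x (i + 1) ∈ U₀ ↔ ¬ x i ∈ U₀) := fun i => by
    rcases hl _ _ _ (hxe i) with ⟨h0, h1⟩ | ⟨h1, h0⟩
    · exact iff_of_false (Set.disjoint_right.1 hd h1) (not_not.2 h0)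
    · exact iff_of_true h0 (Set.disjoint_right.1 hd h1)
  have key : ∀ n : ℕ, (x (Fin.ofNat (k + 1) n) ∈ U₀ ↔ (Even n ↔ x 0 ∈ U₀)) := by
    intro n
    induction n with
    | zero => simp
    | succ n ih =>
      have : Fin.ofNat (k + 1) (n + 1) = Fin.ofNat (k + 1) n + 1 := by
        ext; simp [Fin.val_add]
      rw [this, step, ih, Nat.even_add_one]
      tauto
  have := key (k + 1)
  have h0 : Fin.ofNat (k + 1) (k + 1) = 0 := by ext; simp
  rw [h0] at this
  tauto

/-- A closed walk of odd length with the least length has no repeated vertex. -/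
theorem hasCycle_of_odd_closed_walk {x : ℕ → α} {n : ℕ} (hn : Odd n) (h0 : x n = x 0)
    (hx : ∀ i < n, ∃ e, G.IsLink e (x i) (x (i + 1))) :
    ∃ k, G.HasCycle k ∧ Odd (k + 1) := by
  classical
  induction n using Nat.strong_induction_on generalizing x with
  | _ n ih =>
  by_cases hinj : ∀ i j, i < j → j < n → x i ≠ x j
  · obtain ⟨k, rfl⟩ : ∃ k, n = k + 1 := ⟨n - 1, by have := hn.pos; omega⟩
    choose e he using hx
    have hsucc : ∀ i : Fin (k + 1), x ((i : ℕ) + 1) = x ((i + 1 : Fin (k + 1)) : ℕ) := by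
      intro i
      rcases Fin.eq_castSucc_or_eq_last i with ⟨j, rfl⟩ | rfl
      · simp
      · simp [h0]
    have xinj : Function.Injective fun i : Fin (k + 1) => x i := by
      intro i j hij
      by_contra hne
      rcases lt_or_gt_of_ne hne with h | h
      · exact hinj i j h j.2 hij
      · exact hinj j i h i.2 hij.symm
    have hl : ∀ i : Fin (k + 1), G.IsLink (e i i.2) (x i) (x ((i + 1 : Fin (k + 1)) : ℕ)) :=
      fun i => hsucc i ▸ he i i.2
    refine ⟨k, ⟨fun i => x i, fun i => e i i.2, xinj, fun i j hij => ?_, hl⟩, hn⟩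
    have hi := hl i
    have hj := hl j
    simp only at hij
    rw [hij] at hi
    rcases hi.eq_and_eq_or_eq_and_eq hj with ⟨h, -⟩ | ⟨h, h'⟩
    · exact xinj h
    -- An edge used in opposite directions at two places forces `1 + 1 = 0` in `Fin (k + 1)`, hence
    -- length 1 or 2; length 2 is not odd.
    · have h1 := xinj h
      have h2 := xinj h'
      rw [h1] at h2
      have h3 : (1 : Fin (k + 1)) + 1 = 0 := by
        simpa [add_assoc] using h2
      rcases Nat.lt_or_ge k 2 with hk | hk
      · interval_cases k
        · exact Subsingleton.elim (α := Fin 1) _ _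
        · exact absurd hn (by decide)
      · exfalso
        have := congrArg Fin.val h3
        rw [Fin.val_add, Fin.val_one', Nat.mod_eq_of_lt (by omega : 1 < k + 1),
          Nat.mod_eq_of_lt (by omega)] at this
        simp at this
  · push Not at hinj
    obtain ⟨i, j, hij, hj, hxij⟩ := hinj
    -- A repeated vertex splits the walk into two shorter closed walks whose lengths add up to `n`;
    -- one of them is odd.
    rcases Nat.even_or_odd (j - i) with he | ho
    · refine ih (n - (j - i)) (by omega) ?_
        (x := fun t => if t ≤ i then x t else x (t + (j - i))) ?_ ?_
      · exact Nat.Odd.sub_even (by omega) hn he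
      · simp only [zero_le, if_true]
        rw [if_neg (by omega), ← h0]; congr 1; omega
      · intro t ht
        rcases lt_trichotomy t i with h | h | h
        · simp only [h.le, Nat.succ_le_of_lt h, if_true]; exact hx t (by omega)
        · subst h
          simp only [le_refl, if_true]
          rw [if_neg (by omega), hxij]
          have := hx j hj
          rwa [show t + 1 + (j - t) = j + 1 by omega]
        · rw [if_neg (by omega), if_neg (by omega)]
          have := hx (t + (j - i)) (by omega)
          rwa [show t + 1 + (j - i) = t + (j - i) + 1 by omega]
    · refine ih (j - i) (by omega) ho (x := fun t => x (i + t)) ?_ ?_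
      · simp only [add_zero]
        rw [show i + (j - i) = j by omega, hxij]
      · intro t ht
        exact hx (i + t) (by omega)

theorem bipartite_of_forall_hasCycle_even (h : ∀ k, G.HasCycle k → Even (k + 1)) :
    G.Bipartite := by
  classical
  let S : SimpleGraph α :=
    { Adj := fun x y => ∃ e, G.IsLink e x y
      symm := ⟨fun _ _ ⟨e, he⟩ => ⟨e, he.symm⟩⟩
      loopless := ⟨fun x ⟨e, he⟩ => by
        have := h 0 ⟨fun _ => x, fun _ => e, fun _ _ _ => Subsingleton.elim (α := Fin 1) _ _,
          fun _ _ _ => Subsingleton.elim (α := Fin 1) _ _, fun _ => he⟩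
        exact absurd this (by decide)⟩ }
  have hS : S.Colorable 2 := by
    rw [SimpleGraph.two_colorable_iff_forall_loop_even]
    intro u w
    by_contra hw
    obtain ⟨k, hk, hodd⟩ := hasCycle_of_odd_closed_walk (G := G) (x := w.getVert)
      (Nat.not_even_iff_odd.1 hw) (by simp) fun i hi => w.adj_getVert_succ hi
    exact Nat.not_even_iff_odd.2 hodd (h k hk)
  obtain ⟨C⟩ := hS
  refine ⟨{x ∈ G.vertexSet | C x = 0}, {x ∈ G.vertexSet | C x = 1}, ?_, ?_, ?_⟩
  · rw [Set.disjoint_left]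
    rintro x ⟨-, h0⟩ ⟨-, h1⟩
    rw [h0] at h1
    exact absurd h1 (by decide)
  · ext x
    have : C x = 0 ∨ C x = 1 := by
      generalize C x = y; revert y; decide
    simp only [Set.mem_union, Set.mem_ofPred_eq]
    tauto
  · intro e x y hl
    have hne : C x ≠ C y := C.valid ⟨e, hl⟩
    have hx := hl.left_mem
    have hy := hl.right_mem
    simp only [Set.mem_ofPred_eq, hx, hy, true_and]
    generalize C x = a at *
    generalize C y = b at *
    revert a b; decide

end Graph

/-! ### Incidence matrices of a glued surface. -/

namespace PolygonGluing

variable {P : PolygonGluing.{u}}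

theorem edge_eq_iff {d d' : P.Side} : edge d = edge d' ↔ d = d' ∨ d = P.glue d' := by
  constructor
  · intro h
    obtain ⟨n, hn⟩ := Equiv.Perm.SameCycle.symm (Quotient.exact h)
    have h2 : P.glue ^ (2 : ℤ) = 1 := by
      ext1 d; simp [zpow_ofNat, pow_two, P.glue_glue]
    rcases Int.even_or_odd' n with ⟨k, rfl | rfl⟩
    · left; rw [zpow_mul, h2] at hn; simpa using hn.symm
    · right; rw [zpow_add, zpow_mul, h2] at hn; simpa using hn.symm
  · rintro (rfl | rfl)
    · rfl
    · exact Quotient.sound (Equiv.Perm.SameCycle.symm ⟨1, by simp⟩)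

theorem edge_glue (d : P.Side) : edge (P.glue d) = edge d :=
  edge_eq_iff.2 (.inr rfl)

theorem tail_surjective : Function.Surjective (tail : P.Side → P.Vertex) := Quotient.mk_surjective

theorem tail_turn (d : P.Side) : tail (P.turn d) = tail d :=
  Quotient.sound (Equiv.Perm.SameCycle.symm ⟨1, by simp⟩)

theorem tail_next (d : P.Side) : tail (P.next d) = head d := by
  have := tail_turn (P.glue d)
  rwa [show P.turn (P.glue d) = P.next d by simp [turn, P.glue_glue]] at this

noncomputable section

open Classical in
instance : DecidableEq P.Vertex := inferInstance

open Classical in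
instance : DecidableEq P.Edge := inferInstance

open Classical in
instance : DecidableEq P.Face := inferInstance

/-- The sides on an edge are `d` and `glue d`. -/
theorem sum_sides_of_edge {M : Type*} [AddCommMonoid M] (d : P.Side) (g : P.Side → M) :
    ∑ a : P.Side with edge a = edge d, g a = g d + g (P.glue d) := by
  classical
  have : (Finset.univ.filter fun a : P.Side => edge a = edge d) = {d, P.glue d} := by
    ext a; simp [edge_eq_iff]
  rw [this, Finset.sum_pair (P.glue_ne d).symm]

theorem D_apply (v : P.Vertex) (e : P.Edge) :
    P.D v e = ∑ a : P.Side with edge a = e, if tail a = v then 1 else 0 := by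
  rw [D, Finset.sum_boole, Set.ncard_eq_toFinset_card', Finset.filter_filter]
  congr 2; ext; simp

theorem B_apply (e : P.Edge) (f : P.Face) :
    P.B e f = ∑ a : P.Side with edge a = e, if a.1 = f then 1 else 0 := by
  rw [B, Finset.sum_boole, Set.ncard_eq_toFinset_card', Finset.filter_filter]
  congr 2; ext; simp

theorem vecMul_D_edge (x : P.Vertex → ZMod 2) (d : P.Side) :
    Matrix.vecMul x P.D (edge d) = x (tail d) + x (head d) := by
  simp only [Matrix.vecMul, dotProduct, D_apply, Finset.mul_sum, mul_ite, mul_one, mul_zero]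
  rw [Finset.sum_comm]
  simp only [Finset.sum_ite_eq, Finset.mem_univ, if_true]
  exact sum_sides_of_edge d fun a => x (tail a)

theorem mulVec_B_edge (y : P.Face → ZMod 2) (d : P.Side) :
    Matrix.mulVec P.B y (edge d) = y d.1 + y (P.glue d).1 := by
  simp only [Matrix.mulVec, dotProduct, B_apply, Finset.sum_mul, ite_mul, one_mul, zero_mul]
  rw [Finset.sum_comm]
  simp only [Finset.sum_ite_eq, Finset.mem_univ, if_true]
  exact sum_sides_of_edge d fun a => y a.1

/-- Around `v` each side contributes its own face and the face across it. `turn` permutes the sides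
at `v` and sends a side into the face across it, so the two sums agree and cancel. -/
theorem D_mulVec_B_mulVec (y : P.Face → ZMod 2) :
    Matrix.mulVec P.D (Matrix.mulVec P.B y) = 0 := by
  ext v
  have : ∀ e, P.D v e * Matrix.mulVec P.B y e =
      ∑ a : P.Side with edge a = e,
        if tail a = v then y a.1 + y (P.glue a).1 else 0 := by
    intro e
    rw [D_apply, Finset.sum_mul]
    refine Finset.sum_congr rfl fun a ha => ?_
    rw [← (Finset.mem_filter.1 ha).2, mulVec_B_edge]
    split_ifs <;> simp
  rw [Matrix.mulVec, dotProduct, Finset.sum_congr rfl fun e _ => this e,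
    Finset.sum_fiberwise, ← Finset.sum_filter, Finset.sum_add_distrib, Pi.zero_apply]
  have : ∑ a : P.Side with tail a = v, y (P.glue a).1 = ∑ a : P.Side with tail a = v, y a.1 := by
    refine Finset.sum_equiv P.turn (fun a => ?_) fun a _ => ?_
    · simp [tail_turn]
    · rfl
  rw [this, CharTwo.add_self_eq_zero]

end

end PolygonGluing

/-! ### Homology of the sphere. -/

namespace PlanarPatch

open PolygonGluing

variable {P : PlanarPatch.{u}}

/-- A function of the sides that is invariant under `glue` and `next` is constant. -/
theorem eq_of_invariant {M : Type*} (g : P.Side → M) (h₁ : ∀ d, g (P.glue d) = g d)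
    (h₂ : ∀ d, g (P.next d) = g d) (d d' : P.Side) : g d = g d' := by
  induction P.connected d d' with
  | refl => rfl
  | tail _ h ih => rcases h with rfl | rfl <;> simp [ih, h₁, h₂]

theorem eq_of_vecMul_D_eq_zero {x : P.Vertex → ZMod 2} (h : Matrix.vecMul x P.D = 0)
    (v w : P.Vertex) : x v = x w := by
  obtain ⟨d, rfl⟩ := tail_surjective v
  obtain ⟨d', rfl⟩ := tail_surjective w
  have key : ∀ d : P.Side, x (head d) = x (tail d) := fun d => by
    have := congrFun h (edge d)
    rw [vecMul_D_edge] at this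
    exact (CharTwo.add_eq_zero.1 this).symm
  exact eq_of_invariant (fun d => x (tail d)) key (fun d => by rw [tail_next, key]) d d'

theorem eq_of_mulVec_B_eq_zero {y : P.Face → ZMod 2} (h : Matrix.mulVec P.B y = 0)
    (f g : P.Face) : y f = y g := by
  have key : ∀ d : P.Side, y (P.glue d).1 = y d.1 := fun d => by
    have := congrFun h (edge d)
    rw [mulVec_B_edge] at this
    exact (CharTwo.add_eq_zero.1 this).symm
  exact eq_of_invariant (fun d : P.Side => y d.1) key (fun d => rfl)
    ⟨f, 0, P.deg_pos f⟩ ⟨g, 0, P.deg_pos g⟩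

theorem finrank_le_one_of_forall_eq {n : Type*} [Finite n] (S : Submodule (ZMod 2) (n → ZMod 2))
    (h : ∀ x ∈ S, ∀ i j, x i = x j) : Module.finrank (ZMod 2) S ≤ 1 := by
  cases isEmpty_or_nonempty n
  · exact (Submodule.finrank_le S).trans (by simp [Module.finrank_zero_of_subsingleton])
  · obtain ⟨i⟩ := ‹Nonempty n›
    have : S ≤ Submodule.span (ZMod 2) {fun _ => 1} := fun x hx =>
      Submodule.mem_span_singleton.2 ⟨x i, by ext j; simp [h x hx i j]⟩
    exact (Submodule.finrank_mono this).trans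
      ((finrank_span_le_card _).trans (by simp))

/-- The first homology of the sphere vanishes. -/
theorem exists_mulVec_B_of_mulVec_D_eq_zero {z : P.Edge → ZMod 2}
    (hz : Matrix.mulVec P.D z = 0) : ∃ y, Matrix.mulVec P.B y = z := by
  have hle : LinearMap.range P.B.mulVecLin ≤ LinearMap.ker P.D.mulVecLin := by
    rintro _ ⟨y, rfl⟩
    exact D_mulVec_B_mulVec y
  have hB := LinearMap.finrank_range_add_finrank_ker P.B.mulVecLin
  have hD := LinearMap.finrank_range_add_finrank_ker P.D.mulVecLin
  have hDt := LinearMap.finrank_range_add_finrank_ker P.D.vecMulLinear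
  have hrank : Module.finrank (ZMod 2) (LinearMap.range P.D.mulVecLin) =
      Module.finrank (ZMod 2) (LinearMap.range P.D.vecMulLinear) := by
    have := Matrix.rank_transpose P.D
    rw [Matrix.rank, Matrix.rank] at this
    rw [← this, ← Matrix.mulVecLin_transpose]
  have kB := finrank_le_one_of_forall_eq (LinearMap.ker P.B.mulVecLin)
    fun x hx => eq_of_mulVec_B_eq_zero hx
  have kD := finrank_le_one_of_forall_eq (LinearMap.ker P.D.vecMulLinear)
    fun x hx => eq_of_vecMul_D_eq_zero hx
  have he := P.euler
  simp only [Module.finrank_fintype_fun_eq_card, ← Nat.card_eq_fintype_card] at hB hD hDt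
  -- Both kernels consist of constants, so `rank B ≥ F - 1` and `rank D ≥ V - 1`; Euler's formula
  -- gives `dim ker D ≤ E - V + 1 = F - 1 ≤ rank B`.
  have := Submodule.eq_of_le_of_finrank_le hle (by omega)
  have hz' : z ∈ LinearMap.ker P.D.mulVecLin := hz
  rw [← this] at hz'
  exact hz'

/-! ### Chains of paths and potentials. -/

namespace PrimalPath

/-- Running back along an edge would repeat a vertex. Hence the indicator chain is the sum of the
steps of the path, with no cancellation. -/
theorem edge_side_injective (c : PrimalPath P) : Function.Injective fun i => edge (c.side i) := by
  intro i j hij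
  rcases edge_eq_iff.1 hij with h | h
  · have := congrArg tail h
    rw [c.tail_side, c.tail_side] at this
    exact Fin.castSucc_injective _ (c.vert_injective this)
  · have h1 := congrArg tail h
    have h2 := congrArg head h
    rw [c.tail_side, ← head, c.head_side] at h1
    rw [c.head_side, head, P.glue_glue, c.tail_side] at h2
    have h3 := congrArg Fin.val (c.vert_injective h1)
    have h4 := congrArg Fin.val (c.vert_injective h2)
    simp only [Fin.val_castSucc, Fin.val_succ] at h3 h4
    omega

theorem dotProduct_chain (c : PrimalPath P) (w : P.Edge → ZMod 2) :
    dotProduct w c.chain = ∑ i, w (edge (c.side i)) := by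
  classical
  have : ∀ e, w e * c.chain e = if e ∈ Finset.univ.image (fun i => edge (c.side i))
      then w e else 0 := fun e => by
    simp only [chain, support, Set.indicator_apply, Set.mem_range, Finset.mem_image,
      Finset.mem_univ, true_and, Pi.one_apply]
    split_ifs <;> simp
  simp only [dotProduct, this]
  rw [← Finset.sum_filter, Finset.filter_mem_eq_inter, Finset.univ_inter,
    Finset.sum_image fun i _ j _ h => c.edge_side_injective h]

/-- The sum telescopes along the path: inner vertices occur twice. -/
theorem vecMul_D_dotProduct_chain (c : PrimalPath P) (x : P.Vertex → ZMod 2) :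
    dotProduct (Matrix.vecMul x P.D) c.chain = x c.source + x c.target := by
  rw [dotProduct_chain]
  simp only [vecMul_D_edge, c.tail_side, c.head_side, Finset.sum_add_distrib]
  have h1 := Fin.sum_univ_succ fun i => x (c.vert i)
  have h2 := Fin.sum_univ_castSucc fun i => x (c.vert i)
  rw [source, target]
  have : ∀ a b s t : ZMod 2, a + s = t + b → t + s = a + b := by decide
  exact this _ _ _ _ (h1.symm.trans h2)

theorem dotProduct_mulVec_D_chain (c : PrimalPath P) (x : P.Vertex → ZMod 2) :
    dotProduct x (Matrix.mulVec P.D c.chain) = x c.source + x c.target := by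
  rw [Matrix.dotProduct_mulVec, vecMul_D_dotProduct_chain]

end PrimalPath

section Family

variable {ι : Type*} {c : ι → PrimalPath P}

/-- The first edges of the paths are distinct elements of a finite set. -/
theorem finite_of_pairwise_disjoint
    (hdisj : Pairwise fun a b => Disjoint (c a).support (c b).support) : Finite ι := by
  refine Finite.of_injective (fun a => edge ((c a).side ⟨0, (c a).len_pos⟩)) fun a b hab => ?_
  by_contra hne
  exact Set.disjoint_left.1 (hdisj hne) ⟨_, rfl⟩ ⟨_, hab.symm⟩

theorem bipartite_of_potential {x : P.Vertex → ZMod 2}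
    (hx : ∀ a, x (c a).source + x (c a).target = 1) : (endpointGraph c).Bipartite := by
  have h01 : ∀ s : ZMod 2, s = 0 ∨ s = 1 := by decide
  refine ⟨{v ∈ (endpointGraph c).vertexSet | x v = 0}, {v ∈ (endpointGraph c).vertexSet | x v = 1},
    ?_, ?_, ?_⟩
  · rw [Set.disjoint_left]
    rintro v ⟨-, h0⟩ ⟨-, h1⟩
    rw [h0] at h1
    exact absurd h1 (by decide)
  · ext v
    have := h01 (x v)
    simp only [Set.mem_union, Set.mem_ofPred_eq]
    tauto
  · intro a v w hl
    have hv := hl.left_mem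
    have hw := hl.right_mem
    simp only [Set.mem_ofPred_eq, hv, hw, true_and]
    have : x v + x w = 1 := by
      rcases hl with ⟨rfl, rfl⟩ | ⟨rfl, rfl⟩
      · exact hx a
      · rw [add_comm]; exact hx a
    revert this
    generalize x v = s
    generalize x w = t
    revert s t; decide

theorem exists_potential_of_bipartite (h : (endpointGraph c).Bipartite) :
    ∃ x : P.Vertex → ZMod 2, ∀ a, x (c a).source + x (c a).target = 1 := by
  classical
  obtain ⟨U₀, U₁, hd, -, hl⟩ := h
  refine ⟨fun v => if v ∈ U₀ then 1 else 0, fun a => ?_⟩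
  rcases hl a _ _ (.inl ⟨rfl, rfl⟩) with ⟨h0, h1⟩ | ⟨h1, h0⟩
  · simp [h0, Set.disjoint_right.1 hd h1]
  · simp [h0, Set.disjoint_right.1 hd h1]

/-- If the equations `x u + x v = 1` have no solution, then an odd number of them adds up to
`0 = 1`. -/
theorem exists_potential_of_not_exists_odd [Finite ι]
    (h : ¬ ∃ A : Finset ι, Odd A.card ∧ Matrix.mulVec P.D (∑ a ∈ A, (c a).chain) = 0) :
    ∃ x : P.Vertex → ZMod 2, ∀ a, x (c a).source + x (c a).target = 1 := by
  classical
  cases nonempty_fintype ι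
  let Φ : (P.Vertex → ZMod 2) →ₗ[ZMod 2] (ι → ZMod 2) :=
    { toFun := fun x a => x (c a).source + x (c a).target
      map_add' := fun x y => by ext a; simp only [Pi.add_apply]; ring
      map_smul' := fun r x => by
        ext a; simp only [Pi.smul_apply, smul_eq_mul, RingHom.id_apply]; ring }
  by_contra hno
  have hnot : (1 : ι → ZMod 2) ∉ LinearMap.range Φ := by
    rintro ⟨x, hx⟩
    exact hno ⟨x, fun a => congrFun hx a⟩
  -- A functional on `ι → ZMod 2` is summation over a set `A` of indices. Being nonzero at the
  -- constant 1 makes `A` odd; vanishing on the range of `Φ` makes the boundary of the sum over `A`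
  -- pair to zero with every vertex.
  obtain ⟨φ, hφ, hker⟩ := Submodule.exists_le_ker_of_notMem hnot
  have hφ' : ∀ z : ι → ZMod 2, φ z = ∑ a, z a * φ (Pi.single a 1) := fun z => by
    conv_lhs => rw [← LinearMap.sum_single_apply (fun _ => ZMod 2) z, map_sum]
    refine Finset.sum_congr rfl fun a _ => ?_
    rw [← smul_eq_mul, ← map_smul, ← Pi.single_smul, smul_eq_mul, mul_one]
  have h01 : ∀ s : ZMod 2, s ≠ 0 → s = 1 := by decide
  let A : Finset ι := Finset.univ.filter fun a => φ (Pi.single a 1) = 1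
  have hA : ∀ z : ι → ZMod 2, φ z = ∑ a ∈ A, z a := fun z => by
    rw [hφ', Finset.sum_filter]
    refine Finset.sum_congr rfl fun a _ => ?_
    split_ifs with h1
    · rw [h1, mul_one]
    · rw [not_not.1 fun h0 => h1 (h01 _ h0), mul_zero]
  refine h ⟨A, ?_, ?_⟩
  · have := hA 1
    rw [h01 _ hφ] at this
    rw [← ZMod.natCast_eq_one_iff_odd]
    simpa using this.symm
  · ext v
    have h1 : φ (Φ (Pi.single v 1)) = 0 := hker ⟨_, rfl⟩
    rw [hA] at h1
    have := single_one_dotProduct v (Matrix.mulVec P.D (∑ a ∈ A, (c a).chain))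
    rw [← this, Matrix.mulVec_sum, dotProduct_sum, Pi.zero_apply, ← h1]
    exact Finset.sum_congr rfl fun a _ => (c a).dotProduct_mulVec_D_chain _

/-- A cocycle pairs to zero with boundaries, and vanishing first homology makes the sum over `A` a
boundary. -/
theorem not_exists_odd_of_cocycle {w : P.Edge → ZMod 2}
    (hw : Matrix.mulVec P.B.transpose w = 0) (hc : ∀ a, dotProduct w (c a).chain = 1) :
    ¬ ∃ A : Finset ι, Odd A.card ∧ Matrix.mulVec P.D (∑ a ∈ A, (c a).chain) = 0 := by
  rintro ⟨A, hodd, hA⟩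
  obtain ⟨y, hy⟩ := exists_mulVec_B_of_mulVec_D_eq_zero hA
  have h1 : dotProduct w (∑ a ∈ A, (c a).chain) = 1 := by
    rw [dotProduct_sum, Finset.sum_congr rfl fun a _ => hc a]
    simpa using ZMod.natCast_eq_one_iff_odd.2 hodd
  rw [← hy, Matrix.dotProduct_mulVec, ← Matrix.mulVec_transpose, hw, zero_dotProduct] at h1
  exact absurd h1 (by decide)

end Family

/-- Every arc of a dual loop joins two sides of its polygon. -/
theorem SimpleDualLoop.mulVec_transpose_B_cochain (w : SimpleDualLoop P) :
    Matrix.mulVec P.B.transpose w.cochain = 0 := by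
  have hw : w.cochain = ∑ i, Pi.single (edge (w.side i)) (1 : ZMod 2) := by
    classical
    ext e
    rw [cochain, Set.ncard_eq_toFinset_card', Finset.sum_apply]
    simp only [Pi.single_apply, Finset.sum_boole]
    congr 2; ext i; simp [eq_comm]
  ext f
  rw [hw, Matrix.mulVec_sum, Finset.sum_apply, Pi.zero_apply]
  have : ∀ i, Matrix.mulVec P.B.transpose (Pi.single (edge (w.side i)) (1 : ZMod 2)) f =
      (if (w.side i).1 = f then 1 else 0) + if (w.side (i + 1)).1 = f then 1 else 0 := by
    intro i
    rw [Matrix.mulVec_single_one, ← w.same_face]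
    show P.B _ _ = _
    rw [B_apply, sum_sides_of_edge]
  -- Each crossing counts the polygon it leaves and the one it enters; the latter is left at the
  -- next crossing.
  have hshift : (∑ i, if (w.side (i + 1)).1 = f then (1 : ZMod 2) else 0) =
      ∑ i, if (w.side i).1 = f then 1 else 0 :=
    Equiv.sum_comp (Equiv.addRight (1 : Fin (w.m + 1)))
      fun i => if (w.side i).1 = f then (1 : ZMod 2) else 0
  rw [Finset.sum_congr rfl fun i _ => this i, Finset.sum_add_distrib, hshift,
    CharTwo.add_self_eq_zero]

end PlanarPatch

/-! ### Sides around a vertex and the order of points on a polygon boundary. -/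

namespace PolygonGluing

variable {P : PolygonGluing.{u}}

theorem tail_eq_iff {d d' : P.Side} : tail d = tail d' ↔ P.turn.SameCycle d d' :=
  ⟨fun h => Quotient.exact h, fun h => Quotient.sound h⟩

/-- The sides that start at a vertex, listed clockwise. -/
theorem exists_turn_orbit (d₀ : P.Side) : ∃ (n : ℕ) (g : ℕ → P.Side), g 0 = d₀ ∧
    (∀ j, P.turn (g (j + 1)) = g j) ∧ P.turn d₀ = g n ∧
    (∀ i ≤ n, ∀ j ≤ n, g i = g j → i = j) ∧ ∀ d, tail d = tail d₀ ↔ ∃ j ≤ n, g j = d := by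
  -- With the inverse of `turn`, `glue (g (j + 1))` is followed by `g j` on its polygon, so a curve
  -- entering through `g j` can cut that corner and leave through `glue (g (j + 1))`.
  set τ : Equiv.Perm P.Side := P.turn⁻¹ with hτ
  have hper : d₀ ∈ Function.periodicPts τ := by
    rw [Function.mem_periodicPts]
    refine ⟨orderOf τ, orderOf_pos τ, ?_⟩
    rw [Function.IsPeriodicPt, Function.IsFixedPt, ← Equiv.Perm.coe_pow, pow_orderOf_eq_one]
    rfl
  have hpos := Function.minimalPeriod_pos_of_mem_periodicPts hper
  obtain ⟨n, hn⟩ : ∃ n, Function.minimalPeriod τ d₀ = n + 1 :=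
    ⟨_, (Nat.succ_pred_eq_of_pos hpos).symm⟩
  have hstep : ∀ j, P.turn (τ^[j + 1] d₀) = τ^[j] d₀ := fun j => by
    rw [Function.iterate_succ_apply', hτ]
    exact P.turn.apply_symm_apply _
  refine ⟨n, fun j => τ^[j] d₀, rfl, hstep, ?_, ?_, ?_⟩
  · show _ = τ^[n] d₀
    rw [← hstep n, ← hn, Function.iterate_minimalPeriod]
  · intro i hi j hj hij
    exact Function.iterate_injOn_Iio_minimalPeriod (by simp [hn]; omega) (by simp [hn]; omega) hij
  · intro d
    rw [eq_comm, tail_eq_iff, ← Equiv.Perm.sameCycle_inv]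
    constructor
    · intro h
      obtain ⟨i, hi⟩ := h.exists_nat_pow_eq
      refine ⟨i % (n + 1), Nat.lt_succ_iff.1 (Nat.mod_lt _ n.succ_pos), ?_⟩
      show τ^[_] d₀ = d
      rw [← hn, Function.iterate_mod_minimalPeriod_eq, ← Equiv.Perm.coe_pow, hi]
    · rintro ⟨j, -, rfl⟩
      exact ⟨j, by rw [zpow_natCast, Equiv.Perm.coe_pow]⟩

theorem D_row_eq_sum_single (v : P.Vertex) :
    P.D.row v = ∑ d : P.Side with tail d = v, Pi.single (edge d) (1 : ZMod 2) := by
  ext e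
  rw [Matrix.row, D_apply, Finset.sum_apply]
  simp only [Pi.single_apply, Finset.sum_boole, Finset.filter_filter]
  congr 2; ext d; simp [and_comm, eq_comm]

variable (P) in
/-- A point on the boundary of a polygon: a side and a parameter on it. -/
abbrev BoundaryPoint : Type u := P.Side × ℝ

namespace BoundaryPoint

/-- The boundary point that is glued to a given one. -/
def mirror (x : P.BoundaryPoint) : P.BoundaryPoint := (P.glue x.1, 1 - x.2)

@[simp]
theorem mirror_mirror (x : P.BoundaryPoint) : mirror (mirror x) = x := by
  ext1 <;> simp [mirror, P.glue_glue]

theorem mirror_injective : Function.Injective (mirror (P := P)) :=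
  Function.Involutive.injective mirror_mirror

/-- The position of a boundary point on the circle that bounds its polygon, in `[0, deg]`. -/
noncomputable def angle (x : P.BoundaryPoint) : ℝ := ((x.1.2 : ℕ) : ℝ) + x.2

open Classical in
/-- Whether `y` follows `x` on the boundary of one polygon, as an element of `𝔽₂`. -/
noncomputable def prec (x y : P.BoundaryPoint) : ZMod 2 :=
  if x.1.1 = y.1.1 ∧ angle x < angle y then 1 else 0

/-- The number, mod 2, of points among `c`, `d` that lie between `a` and `b`. -/
noncomputable def crossParity (a b c d : P.BoundaryPoint) : ZMod 2 :=
  (prec a c + prec b c) + (prec a d + prec b d)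

/-- Chords do not interlace when both ends of one have the same position `κ` relative to the other;
chords in different polygons never do. -/
theorem crossParity_eq_zero {a b c d : P.BoundaryPoint} (hab : a.1.1 = b.1.1)
    (hcd : c.1.1 = d.1.1) {κ : ZMod 2} (hc : c.1.1 = a.1.1 → prec a c + prec b c = κ)
    (hd : d.1.1 = a.1.1 → prec a d + prec b d = κ) : crossParity a b c d = 0 := by
  by_cases h : c.1.1 = a.1.1
  · rw [crossParity, hc h, hd (hcd ▸ h), CharTwo.add_self_eq_zero]
  · have h1 : ¬ a.1.1 = c.1.1 := fun h' => h h'.symm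
    have h2 : ¬ b.1.1 = c.1.1 := hab ▸ h1
    simp [crossParity, prec, h1, h2, ← hcd]

/-- Two points of one side are not separated by points that do not lie between them. -/
theorem prec_add_prec_of_same_side {g : P.Side} {t t' : ℝ} (htt : t < t') (ht : 0 < t)
    (ht' : t' < 1) {c : P.BoundaryPoint} (hc : c.2 ∈ Set.Ioo (0 : ℝ) 1)
    (hcg : c.1 = g → c.2 < t) : prec (g, t) c + prec (g, t') c = 0 := by
  obtain ⟨⟨f, i⟩, s⟩ := c
  obtain ⟨f', j⟩ := g
  obtain ⟨h0, h1⟩ := hc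
  by_cases hf : f' = f
  swap
  · simp [prec, hf]
  subst hf
  simp only at h0 h1
  rcases lt_trichotomy i j with h | rfl | h
  · have : ((i : ℕ) : ℝ) + 1 ≤ (j : ℕ) := by exact_mod_cast h
    simp only [prec, angle, true_and]
    rw [if_neg (by linarith), if_neg (by linarith), add_zero]
  · have := hcg rfl
    simp only at this
    simp only [prec, angle, true_and]
    rw [if_neg (by linarith), if_neg (by linarith), add_zero]
  · have : ((j : ℕ) : ℝ) + 1 ≤ (i : ℕ) := by exact_mod_cast h
    simp only [prec, angle, true_and]
    rw [if_pos (by linarith), if_pos (by linarith), CharTwo.add_self_eq_zero]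

open Classical in
/-- Whether a side is the last one of its polygon. -/
noncomputable def wrap (g : P.Side) : ZMod 2 := if (g.2 : ℕ) + 1 = P.deg g.1 then 1 else 0

theorem next_snd_val (f : P.Face) (j : Fin (P.deg f)) :
    (((P.next ⟨f, j⟩).2 : Fin _) : ℕ) = if (j : ℕ) + 1 = P.deg f then 0 else (j : ℕ) + 1 := by
  show ((finRotate (P.deg f) j : Fin _) : ℕ) = _
  generalize P.deg f = n at *
  cases n with
  | zero => exact j.elim0
  | succ n => rw [coe_finRotate]; simp only [Fin.ext_iff, Fin.val_last, Nat.add_right_cancel_iff]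

/-- A point outside the corner between a side and the next one does not separate the two points
of the corner. -/
theorem prec_add_prec_of_corner {g : P.Side} {δ δ' : ℝ} (hδ : δ ∈ Set.Ioo (0 : ℝ) 1)
    (hδ' : δ' ∈ Set.Ioo (0 : ℝ) 1) {c : P.BoundaryPoint} (hc : c.2 ∈ Set.Ioo (0 : ℝ) 1)
    (hcf : c.1.1 = g.1) (hcg : c.1 = g → c.2 < 1 - δ) (hcn : c.1 = P.next g → δ' < c.2) :
    prec (g, 1 - δ) c + prec (P.next g, δ') c = wrap g ∧
      prec c (g, 1 - δ) + prec c (P.next g, δ') = wrap g := by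
  obtain ⟨⟨f, i⟩, s⟩ := c
  obtain ⟨f', j⟩ := g
  obtain ⟨h0, h1⟩ := hc
  obtain ⟨hδ0, hδ1⟩ := hδ
  obtain ⟨hδ0', hδ1'⟩ := hδ'
  obtain rfl : f = f' := hcf
  simp only at h0 h1 hcg hcn
  have hg : i = j → s < 1 - δ := fun h => hcg (by rw [h])
  have hn : (i : ℕ) = (((P.next ⟨f, j⟩).2 : Fin _) : ℕ) → δ' < s := fun h =>
    hcn (Sigma.ext rfl (heq_of_eq (Fin.ext h)))
  have hnf : (P.next ⟨f, j⟩).1 = f := rfl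
  simp only [prec, angle, wrap, hnf, true_and]
  rw [next_snd_val] at hn ⊢
  have hij := i.2
  split_ifs at hn with hw
  -- The corner from the last side to side 0 contains the cut of the angular order, so all points
  -- outside it lie between its two points.
  · have hi : (i : ℕ) ≤ j := by omega
    have a1 : ((i : ℕ) : ℝ) + s < (j : ℕ) + (1 - δ) := by
      rcases hi.lt_or_eq with h | h
      · have : ((i : ℕ) : ℝ) + 1 ≤ (j : ℕ) := by exact_mod_cast h
        linarith
      · have := hg (Fin.ext h)
        rw [h]; linarith
    have a2 : ((0 : ℕ) : ℝ) + δ' < (i : ℕ) + s := by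
      rcases Nat.eq_zero_or_pos (i : ℕ) with h | h
      · have := hn h
        rw [h]; linarith
      · have : (1 : ℝ) ≤ (i : ℕ) := by exact_mod_cast h
        simp only [Nat.cast_zero]; linarith
    simp only [hw, if_true]
    simp only [not_lt.2 a1.le, a1, a2, not_lt.2 a2.le, if_true, if_false, zero_add, add_zero,
      and_self]
  · simp only [hw, if_false]
    rcases Nat.lt_or_ge (j : ℕ) i with h | h
    · have a0 : ((j : ℕ) : ℝ) + 1 ≤ (i : ℕ) := by exact_mod_cast h
      have a1 : ((j : ℕ) : ℝ) + (1 - δ) < (i : ℕ) + s := by linarith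
      have a2 : (((j : ℕ) + 1 : ℕ) : ℝ) + δ' < (i : ℕ) + s := by
        push_cast
        rcases (Nat.succ_le_of_lt h).lt_or_eq with h' | h'
        · have : ((j : ℕ) : ℝ) + 1 + 1 ≤ (i : ℕ) := by exact_mod_cast h'
          linarith
        · have := hn h'.symm
          linarith
      simp only [a1, a2, not_lt.2 a1.le, not_lt.2 a2.le, if_true, if_false,
        CharTwo.add_self_eq_zero, and_self]
    · have a0 : ((i : ℕ) : ℝ) ≤ (j : ℕ) := by exact_mod_cast h
      have a1 : ((i : ℕ) : ℝ) + s < (j : ℕ) + (1 - δ) := by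
        rcases h.lt_or_eq with h | h
        · have : ((i : ℕ) : ℝ) + 1 ≤ (j : ℕ) := by exact_mod_cast h
          linarith
        · have := hg (Fin.ext h)
          rw [h]; linarith
      have a2 : ((i : ℕ) : ℝ) + s < (((j : ℕ) + 1 : ℕ) : ℝ) + δ' := by
        push_cast; linarith
      simp only [a1, a2, not_lt.2 a1.le, not_lt.2 a2.le, if_true, if_false,
        CharTwo.add_self_eq_zero, and_self]

end BoundaryPoint

end PolygonGluing

/-! ### Consecutive pairs in cyclic lists. -/

namespace List

variable {α β : Type*}

/-- The pairs of consecutive elements of the list `x :: l ++ [z]`. -/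
def links : α → List α → α → List (α × α)
  | x, [], z => [(x, z)]
  | x, y :: l, z => (x, y) :: links y l z

theorem links_append_cons (x : α) (l₁ : List α) (y : α) (l₂ : List α) (z : α) :
    links x (l₁ ++ y :: l₂) z = links x l₁ y ++ links y l₂ z := by
  induction l₁ generalizing x with
  | nil => rfl
  | cons a l ih => simp [links, ih]

theorem links_map_range (f : ℕ → α) (n : ℕ) (x : α) :
    links x ((range n).map f) (f n) =
      (x, f 0) :: (range n).map fun j => (f j, f (j + 1)) := by
  induction n generalizing f x with
  | zero => rfl
  | succ n ih =>
    rw [range_succ_eq_map, map_cons, map_map, links, map_cons, map_map]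
    have := ih (fun j => f (j + 1)) (f 0)
    simpa [Function.comp_def] using this

/-- Only the first link depends on `x`; thus a detour inserted after `x` leaves the links `T` of the
old loop untouched. -/
theorem exists_links_eq_cons (l : List α) (z : α) :
    ∃ h T, (∀ x, links x l z = (x, h) :: T) ∧ (h ∈ l ∨ h = z) ∧
      ∀ c ∈ T, c.1 ∈ l ∧ (c.2 ∈ l ∨ c.2 = z) := by
  induction l with
  | nil => exact ⟨z, [], fun _ => rfl, by simp, by simp⟩
  | cons y l ih =>
    obtain ⟨h, T, hT, hh, hc⟩ := ih
    refine ⟨y, (y, h) :: T, fun x => by rw [links, hT], by simp, ?_⟩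
    intro c hcT
    rcases mem_cons.1 hcT with rfl | hcT
    · exact ⟨by simp, hh.imp (mem_cons_of_mem _) id⟩
    · exact ⟨mem_cons_of_mem _ (hc c hcT).1, (hc c hcT).2.imp (mem_cons_of_mem _) id⟩

theorem links_reverse_map (f : α → β) (x : α) (l : List α) (z : α) :
    links (f z) (l.map f).reverse (f x) =
      ((links x l z).map fun c => (f c.2, f c.1)).reverse := by
  induction l generalizing x with
  | nil => rfl
  | cons y l ih =>
    rw [map_cons, reverse_cons, links_append_cons, ih y, links, links, map_cons, reverse_cons]

end List

/-! ### Chord loops and the detour around a vertex. -/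

namespace PolygonGluing

open BoundaryPoint

variable {P : PolygonGluing.{u}}

/-- Two chords do not cross. A chord is given by the crossing at which it enters the polygon and
the one at which it leaves it; it starts at the mirror image of the former. -/
def Noncrossing (c c' : P.BoundaryPoint × P.BoundaryPoint) : Prop :=
  crossParity (mirror c.1) c.2 (mirror c'.1) c'.2 = 0 ∨
    crossParity (mirror c'.1) c'.2 (mirror c.1) c.2 = 0

/-- The disjunctive definition gives symmetry without a proof that `crossParity` is symmetric. -/
theorem Noncrossing.symm {c c' : P.BoundaryPoint × P.BoundaryPoint} (h : Noncrossing c c') :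
    Noncrossing c' c := Or.symm h

/-- The boundary points through which a list of crossings passes. -/
def points (L : List P.BoundaryPoint) : List P.BoundaryPoint := L ++ L.map mirror

theorem mem_points {L : List P.BoundaryPoint} {y : P.BoundaryPoint} :
    y ∈ points L ↔ y ∈ L ∨ mirror y ∈ L := by
  rw [points, List.mem_append, List.mem_map]
  refine or_congr_right ⟨?_, fun h => ⟨_, h, mirror_mirror y⟩⟩
  rintro ⟨z, hz, rfl⟩
  rwa [mirror_mirror]

theorem mirror_mem_points {L : List P.BoundaryPoint} {y : P.BoundaryPoint} :
    mirror y ∈ points L ↔ y ∈ points L := by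
  rw [mem_points, mem_points, mirror_mirror, or_comm]

/-- The cyclic list `x :: l` of crossings describes a simple closed curve that runs along chords
of the polygons. -/
structure IsChordLoop (x : P.BoundaryPoint) (l : List P.BoundaryPoint) : Prop where
  pos_mem : ∀ y ∈ x :: l, y.2 ∈ Set.Ioo (0 : ℝ) 1
  nodup : (points (x :: l)).Nodup
  same_face : ∀ c ∈ List.links x l x, (P.glue c.1.1).1 = c.2.1.1
  noncrossing : (List.links x l x).Pairwise Noncrossing

/-- The number of crossings with each edge, mod 2. -/
noncomputable def crossingCochain (L : List P.BoundaryPoint) : P.Edge → ZMod 2 :=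
  (L.map fun y => Pi.single (edge y.1) (1 : ZMod 2)).sum

/-- The edge of `d` is crossed. -/
def IsCrossed (L : List P.BoundaryPoint) (d : P.Side) : Prop := ∃ s, (d, s) ∈ points L

theorem IsCrossed.glue {L : List P.BoundaryPoint} {d : P.Side} (h : IsCrossed L d) :
    IsCrossed L (P.glue d) := by
  obtain ⟨s, hs⟩ := h
  exact ⟨1 - s, mirror_mem_points.2 hs⟩

theorem points_pos_mem {L : List P.BoundaryPoint} (h : ∀ y ∈ L, y.2 ∈ Set.Ioo (0 : ℝ) 1) :
    ∀ y ∈ points L, y.2 ∈ Set.Ioo (0 : ℝ) 1 := by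
  intro y hy
  rcases mem_points.1 hy with hy | hy
  · exact h y hy
  · have := h _ hy
    simp only [mirror, Set.mem_Ioo] at this ⊢
    constructor <;> linarith [this.1, this.2]

theorem points_perm {L L' : List P.BoundaryPoint} (h : L.Perm L') : (points L).Perm (points L') :=
  h.append (h.map _)

namespace IsChordLoop

variable {x : P.BoundaryPoint} {l : List P.BoundaryPoint}

theorem rotate {y : P.BoundaryPoint} {l₁ l₂ : List P.BoundaryPoint}
    (h : IsChordLoop x (l₁ ++ y :: l₂)) : IsChordLoop y (l₂ ++ x :: l₁) := by
  have hp : (x :: (l₁ ++ y :: l₂)).Perm (y :: (l₂ ++ x :: l₁)) :=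
    List.perm_append_comm (l₁ := x :: l₁) (l₂ := y :: l₂)
  have hl : (List.links x (l₁ ++ y :: l₂) x).Perm (List.links y (l₂ ++ x :: l₁) y) := by
    rw [List.links_append_cons, List.links_append_cons]
    exact List.perm_append_comm
  exact ⟨fun z hz => h.pos_mem z (hp.mem_iff.2 hz), (points_perm hp).nodup_iff.1 h.nodup,
    fun c hc => h.same_face c (hl.mem_iff.2 hc), h.noncrossing.perm hl Noncrossing.symm⟩

/-- Traversed backwards, each crossing is approached from the other polygon, which replaces it by
its mirror image; each chord only swaps its ends. -/
theorem reverse (h : IsChordLoop x l) : IsChordLoop (mirror x) (l.map mirror).reverse := by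
  have hp : (mirror x :: (l.map mirror).reverse).Perm ((x :: l).map mirror) :=
    List.Perm.cons _ (List.reverse_perm _)
  refine ⟨?_, ?_, ?_, ?_⟩
  · intro y hy
    obtain ⟨z, hz, rfl⟩ := List.mem_map.1 (hp.mem_iff.1 hy)
    exact points_pos_mem h.pos_mem _ (mirror_mem_points.2 (mem_points.2 (.inl hz)))
  · rw [(points_perm hp).nodup_iff, points, List.map_map,
      show mirror ∘ mirror = (id : P.BoundaryPoint → _) from funext mirror_mirror, List.map_id,
      List.perm_append_comm.nodup_iff]
    exact h.nodup
  · rw [List.links_reverse_map]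
    intro c hc
    obtain ⟨c', hc', rfl⟩ := List.mem_map.1 (List.mem_reverse.1 hc)
    have := h.same_face c' hc'
    simp only [mirror, P.glue_glue, this]
  · rw [List.links_reverse_map, List.pairwise_reverse, List.pairwise_map]
    refine h.noncrossing.imp ?_
    intro c c' hcc
    have aux : ∀ a b c d : P.BoundaryPoint, crossParity a b c d = crossParity b a d c := by
      intro a b c d
      simp only [crossParity]; ring
    rw [Noncrossing, mirror_mirror, mirror_mirror, aux, aux c.2]
    exact hcc.symm

/-- The boundary of a small bigon that meets one edge. -/
theorem bigon (d : P.Side) : IsChordLoop (d, 1 / 3) [(P.glue d, 1 / 3)] := by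
  -- Seen from `d` the two crossings have parameters 1/3 and 2/3. One chord has both ends on `d`,
  -- the other both on `glue d`.
  have h1 := P.glue_ne d
  refine ⟨?_, ?_, ?_, ?_⟩
  · simp; norm_num
  · simp [points, mirror, P.glue_glue, h1, h1.symm]; norm_num
  · simp [List.links, P.glue_glue]
  · simp only [List.links, List.pairwise_cons, List.mem_singleton, forall_eq, List.not_mem_nil,
      IsEmpty.forall_iff, implies_true, List.Pairwise.nil, and_true]
    right
    refine crossParity_eq_zero (by simp [mirror, P.glue_glue]) rfl (κ := 0) (fun _ => ?_) fun _ => ?_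
    · simp only [mirror, P.glue_glue]
      rw [add_comm]
      exact prec_add_prec_of_same_side (by norm_num) (by norm_num) (by norm_num) (by norm_num)
        fun h => absurd h h1
    · simp only [mirror, P.glue_glue]
      rw [add_comm]
      exact prec_add_prec_of_same_side (by norm_num) (by norm_num) (by norm_num) (by norm_num)
        fun h => absurd h h1

end IsChordLoop

theorem exists_lt_of_forall_pos (L : List ℝ) (h : ∀ a ∈ L, 0 < a) :
    ∃ ε : ℝ, 0 < ε ∧ ε < 1 / 2 ∧ ∀ a ∈ L, ε < a := by
  induction L with
  | nil => exact ⟨1 / 4, by norm_num, by norm_num, by simp⟩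
  | cons b L ih =>
    obtain ⟨ε, h0, h1, h2⟩ := ih fun a ha => h a (List.mem_cons_of_mem _ ha)
    have hb := h b List.mem_cons_self
    refine ⟨min ε (b / 2), lt_min h0 (by linarith), (min_le_left _ _).trans_lt h1, ?_⟩
    intro a ha
    rcases List.mem_cons.1 ha with rfl | ha
    · exact (min_le_right _ _).trans_lt (by linarith)
    · exact (min_le_left _ _).trans_lt (h2 a ha)

namespace IsChordLoop

/-- The curve follows the edge of `d₀` from the crossing that is nearest to the start of `d₀`,
and then runs once around that vertex. -/
theorem encircle_of_nearest {d₀ : P.Side} {p : ℝ} {l : List P.BoundaryPoint}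
    (h : IsChordLoop (d₀, p) l) (near : ∀ s, (d₀, s) ∈ points ((d₀, p) :: l) → p ≤ s) :
    ∃ K : List P.BoundaryPoint, IsChordLoop (d₀, p) (K ++ l) ∧
      crossingCochain K = P.D.row (tail d₀) ∧ ∀ d, tail d = tail d₀ → IsCrossed K d := by
  classical
  have hpts := points_pos_mem h.pos_mem
  -- The circle is drawn at distance `ε` from the vertex, nearer than every old crossing; `points`
  -- is closed under `mirror`, so this holds at both ends of each side.
  obtain ⟨ε, hε0, hε2, hε⟩ := exists_lt_of_forall_pos ((points ((d₀, p) :: l)).map Prod.snd) (by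
    intro a ha
    obtain ⟨y, hy, rfl⟩ := List.mem_map.1 ha
    exact (hpts y hy).1)
  have hold : ∀ y ∈ points ((d₀, p) :: l), ε < y.2 ∧ y.2 < 1 - ε := fun y hy => by
    have h1 := hε _ (List.mem_map_of_mem hy)
    have h2 := hε _ (List.mem_map_of_mem (mirror_mem_points.2 hy))
    simp only [mirror] at h2
    exact ⟨h1, by linarith⟩
  have hx : (d₀, p) ∈ points ((d₀, p) :: l) := mem_points.2 (.inl List.mem_cons_self)
  have hp0 := hold _ hx
  have hp1 := hpts _ hx
  have hmx := mirror_mem_points.2 hx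
  have hmxeq : mirror (d₀, p) = (P.glue d₀, 1 - p) := rfl
  simp only [Set.mem_Ioo] at hp0 hp1
  have hIε : ε ∈ Set.Ioo (0 : ℝ) 1 := ⟨hε0, by linarith⟩
  have hI1ε : 1 - ε ∈ Set.Ioo (0 : ℝ) 1 := ⟨by linarith, by linarith⟩
  have hfar : ∀ y ∈ points ((d₀, p) :: l), y ≠ mirror (d₀, p) → y.1 = P.glue d₀ →
      y.2 < 1 - p := by
    intro y hy hne hyd
    have hm : mirror y = (d₀, 1 - y.2) := by
      rw [mirror, hyd, P.glue_glue]
    have h1 := near (1 - y.2) (hm ▸ mirror_mem_points.2 hy)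
    refine lt_of_le_of_ne (by linarith) fun h2 => hne ?_
    exact Prod.ext hyd h2
  obtain ⟨n, g, hg0, hgs, hgn, hginj, hgmem⟩ := exists_turn_orbit d₀
  have hnext : ∀ j, P.next (P.glue (g (j + 1))) = g j := hgs
  have hnextn : P.next (P.glue d₀) = g n := hgn
  -- Crossing `f j` enters the polygon of `g j` at its point `ε`. After `f n` the curve is back in
  -- the polygon of `glue d₀`, since `g n` follows `glue d₀`.
  set f : ℕ → P.BoundaryPoint := fun j => (P.glue (g j), 1 - ε) with hf
  have hmf : ∀ j, mirror (f j) = (g j, ε) := fun j => by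
    simp [hf, mirror, P.glue_glue]
  obtain ⟨b, T, hT, hb, hTmem⟩ := List.exists_links_eq_cons l (d₀, p)
  have hb' : b ∈ (d₀, p) :: l := List.mem_cons.2 hb.symm
  have hnd := h.nodup
  rw [points, List.nodup_append] at hnd
  obtain ⟨hndL, -, hdis⟩ := hnd
  have hbpt : b ∈ points ((d₀, p) :: l) := mem_points.2 (.inl hb')
  have hne_mirror : ∀ y ∈ (d₀, p) :: l, y ≠ mirror (d₀, p) := fun y hy =>
    hdis y hy _ (List.mem_map_of_mem List.mem_cons_self)
  have hTpt : ∀ c ∈ T, (mirror c.1 ∈ points ((d₀, p) :: l) ∧ mirror c.1 ≠ mirror (d₀, p)) ∧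
      (c.2 ∈ points ((d₀, p) :: l) ∧ c.2 ≠ mirror (d₀, p)) := by
    intro c hc
    obtain ⟨h1, h2⟩ := hTmem c hc
    have h2' : c.2 ∈ (d₀, p) :: l := List.mem_cons.2 h2.symm
    refine ⟨⟨mirror_mem_points.2 (mem_points.2 (.inl (List.mem_cons_of_mem _ h1))), ?_⟩,
      mem_points.2 (.inl h2'), hne_mirror _ h2'⟩
    rw [mirror_injective.ne_iff]
    rintro h3
    exact (List.nodup_cons.1 hndL).1 (h3 ▸ h1)
  have hsf := h.same_face
  have hnc := h.noncrossing
  rw [hT] at hsf hnc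
  rw [List.pairwise_cons] at hnc
  have hbface : (P.glue d₀).1 = b.1.1 := hsf _ List.mem_cons_self
  have hTface : ∀ c ∈ T, (mirror c.1).1.1 = c.2.1.1 := fun c hc =>
    hsf c (List.mem_cons_of_mem _ hc)
  have hglue_face : ∀ j, (P.glue (g (j + 1))).1 = (g j).1 := fun j => by rw [← hnext j]; rfl
  have hgn_face : (g n).1 = b.1.1 := by rw [← hbface, ← hnextn]; rfl
  -- chords in the corners at the vertex
  have corner : ∀ j < n, ∀ c : P.BoundaryPoint × P.BoundaryPoint, (mirror c.1).1.1 = c.2.1.1 →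
      (∀ y, y = mirror c.1 ∨ y = c.2 → y ∈ points ((d₀, p) :: l) ∨
        (∃ i ≤ n, i ≠ j ∧ y = (g i, ε)) ∨ ∃ i ≤ n, i ≠ j + 1 ∧ y = (P.glue (g i), 1 - ε)) →
      Noncrossing (f j, f (j + 1)) c := by
    intro j hj c hcf hc
    have key : ∀ y, y = mirror c.1 ∨ y = c.2 → y.1.1 = (g j).1 →
        prec (g j, ε) y + prec (P.glue (g (j + 1)), 1 - ε) y = wrap (P.glue (g (j + 1))) := by
      intro y hy hyf
      rw [add_comm, ← hnext j]
      refine (prec_add_prec_of_corner hIε hIε ?_ (by rw [hyf, hglue_face]) ?_ ?_).1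
      · rcases hc y hy with h | ⟨i, -, -, rfl⟩ | ⟨i, -, -, rfl⟩
        exacts [hpts y h, hIε, hI1ε]
      · rcases hc y hy with h | ⟨i, -, -, rfl⟩ | ⟨i, hi, hij, rfl⟩
        · exact fun _ => (hold y h).2
        · exact fun _ => by simp only; linarith
        · exact fun h => absurd (hginj i hi (j + 1) hj (P.glue.injective h)) hij
      · rw [hnext]
        rcases hc y hy with h | ⟨i, hi, hij, rfl⟩ | ⟨i, -, -, rfl⟩
        · exact fun _ => (hold y h).1
        · exact fun h => absurd (hginj i hi j hj.le h) hij
        · exact fun _ => by simp only; linarith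
    left
    simp only [hmf]
    exact crossParity_eq_zero (hglue_face j).symm hcf (key _ (.inl rfl)) (key _ (.inr rfl))
  -- the chord along the edge
  have along : ∀ c : P.BoundaryPoint × P.BoundaryPoint, (mirror c.1).1.1 = c.2.1.1 →
      (∀ y, y = mirror c.1 ∨ y = c.2 → (y ∈ points ((d₀, p) :: l) ∧ y ≠ mirror (d₀, p)) ∨
        y = (g n, ε)) →
      Noncrossing ((d₀, p), f 0) c := by
    intro c hcf hc
    have key : ∀ y, y = mirror c.1 ∨ y = c.2 →
        prec (P.glue d₀, 1 - p) y + prec (P.glue d₀, 1 - ε) y = 0 := by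
      intro y hy
      refine prec_add_prec_of_same_side (by linarith) (by linarith) (by linarith) ?_ ?_
      · rcases hc y hy with ⟨h, -⟩ | rfl
        exacts [hpts y h, hIε]
      · rcases hc y hy with ⟨h, hne⟩ | rfl
        · exact hfar y h hne
        · exact fun _ => by simp only; linarith
    left
    simp only [hf, hg0, hmxeq]
    exact crossParity_eq_zero rfl hcf (fun _ => key _ (.inl rfl)) (fun _ => key _ (.inr rfl))
  -- The old first chord, to `b`, becomes a chord along the edge, `n` corner chords, and a chord to
  -- `b` from the other side of the corner after `glue d₀`.
  have hlinks : List.links (d₀, p) ((List.range n).map f ++ f n :: l) (d₀, p) =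
      ((d₀, p), f 0) :: ((List.range n).map (fun j => (f j, f (j + 1))) ++ (f n, b) :: T) := by
    rw [List.links_append_cons, List.links_map_range, hT, List.cons_append]
  have hK : ((List.range n).map f ++ f n :: l) = (List.range (n + 1)).map f ++ l := by
    rw [List.range_succ, List.map_append, List.append_assoc]; rfl
  have hmemK : ∀ y, y ∈ (List.range (n + 1)).map f ↔ ∃ j ≤ n, f j = y := fun y => by
    simp
  have hZface : (mirror (f n)).1.1 = b.1.1 := by rw [hmf]; exact hgn_face
  refine ⟨(List.range (n + 1)).map f, ⟨?_, ?_, ?_, ?_⟩, ?_, ?_⟩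
  · intro y hy
    rw [List.mem_cons, List.mem_append, hmemK] at hy
    rcases hy with rfl | ⟨j, -, rfl⟩ | hy
    · exact hp1
    · exact hI1ε
    · exact h.pos_mem y (List.mem_cons_of_mem _ hy)
  · have hperm : ((d₀, p) :: ((List.range (n + 1)).map f ++ l)).Perm
        ((List.range (n + 1)).map f ++ (d₀, p) :: l) := List.perm_middle.symm
    have hperm2 : (points ((List.range (n + 1)).map f ++ (d₀, p) :: l)).Perm
        (points ((List.range (n + 1)).map f) ++ points ((d₀, p) :: l)) := by
      rw [points, points, points, List.map_append, List.append_assoc, List.append_assoc]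
      refine List.Perm.append_left _ ?_
      rw [← List.append_assoc, ← List.append_assoc]
      exact List.Perm.append_right _ List.perm_append_comm
    rw [((points_perm hperm).trans hperm2).nodup_iff, List.nodup_append]
    have hfinj : ∀ i ∈ List.range (n + 1), ∀ j ∈ List.range (n + 1), f i = f j → i = j := by
      intro i hi j hj hij
      rw [List.mem_range, Nat.lt_succ_iff] at hi hj
      exact hginj i hi j hj (P.glue.injective (congrArg Prod.fst hij))
    have hndK : ((List.range (n + 1)).map f).Nodup :=
      List.Nodup.map_on hfinj List.nodup_range
    refine ⟨?_, h.nodup, ?_⟩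
    · rw [points, List.nodup_append]
      refine ⟨hndK, hndK.map mirror_injective, ?_⟩
      intro y hy z hz hyz
      obtain ⟨j, -, rfl⟩ := (hmemK y).1 hy
      obtain ⟨w, hw, rfl⟩ := List.mem_map.1 hz
      obtain ⟨i, -, rfl⟩ := (hmemK w).1 hw
      rw [hmf] at hyz
      have := congrArg Prod.snd hyz
      simp only [hf] at this
      linarith
    · intro y hy z hz hyz
      subst hyz
      have h1 := hold y hz
      rcases mem_points.1 hy with hy | hy
      · obtain ⟨j, -, rfl⟩ := (hmemK y).1 hy
        simp only [hf] at h1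
        linarith
      · obtain ⟨j, -, hj⟩ := (hmemK _).1 hy
        rw [← mirror_mirror y, ← hj, hmf] at h1
        simp only at h1
        linarith
  · rw [← hK, hlinks]
    intro c hc
    rcases List.mem_cons.1 hc with rfl | hc
    · simp only [hf, hg0]
    rcases List.mem_append.1 hc with hc | hc
    · obtain ⟨j, -, rfl⟩ := List.mem_map.1 hc
      simp only [hf, P.glue_glue, hglue_face]
    rcases List.mem_cons.1 hc with rfl | hc
    · exact hZface
    · exact hTface c hc
  · rw [← hK, hlinks, List.pairwise_cons, List.pairwise_append, List.pairwise_cons]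
    have hZpt : ∀ y, y = mirror (f n) ∨ y = b →
        (y ∈ points ((d₀, p) :: l) ∧ y ≠ mirror (d₀, p)) ∨ y = (g n, ε) := by
      rintro y (rfl | rfl)
      · exact .inr (hmf n)
      · exact .inl ⟨hbpt, hne_mirror _ hb'⟩
    have hTpt' : ∀ c ∈ T, ∀ y, y = mirror c.1 ∨ y = c.2 →
        y ∈ points ((d₀, p) :: l) ∧ y ≠ mirror (d₀, p) := by
      rintro c hc y (rfl | rfl)
      exacts [(hTpt c hc).1, (hTpt c hc).2]
    refine ⟨?_, ?_, ⟨?_, hnc.2⟩, ?_⟩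
    · intro c hc
      rcases List.mem_append.1 hc with hc | hc
      · obtain ⟨j, hj, rfl⟩ := List.mem_map.1 hc
        refine (corner j (List.mem_range.1 hj) _ ?_ ?_).symm
        · simp only [hf, hg0, hmxeq]
        · rintro y (rfl | rfl)
          · exact .inl hmx
          · exact .inr (.inr ⟨0, Nat.zero_le _, by omega, rfl⟩)
      rcases List.mem_cons.1 hc with rfl | hc
      · exact along _ hZface hZpt
      · exact along c (hTface c hc) fun y hy => .inl (hTpt' c hc y hy)
    · rw [List.pairwise_map]
      refine List.Pairwise.imp_of_mem ?_ List.nodup_range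
      intro i j hi hj hij
      rw [List.mem_range] at hi hj
      refine corner i hi _ ?_ ?_
      · rw [hmf]; exact (hglue_face j).symm
      · rintro y (rfl | rfl)
        · exact .inr (.inl ⟨j, hj.le, Ne.symm hij, hmf j⟩)
        · exact .inr (.inr ⟨j + 1, hj, by omega, rfl⟩)
    · intro c hc
      -- The chord to `b` has moved its start across a corner that contains no end of `c`, by
      -- minimality of `p`. Both ends of `c` see the same change, so the old parity survives.
      have key : ∀ y, y = mirror c.1 ∨ y = c.2 → y.1.1 = (P.glue d₀).1 →
          prec (P.glue d₀, 1 - p) y + prec (g n, ε) y = wrap (P.glue d₀) ∧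
          prec y (P.glue d₀, 1 - p) + prec y (g n, ε) = wrap (P.glue d₀) := by
        intro y hy hyf
        obtain ⟨h1, h2⟩ := hTpt' c hc y hy
        rw [← hnextn]
        exact prec_add_prec_of_corner hp1 hIε (hpts y h1) hyf (hfar y h1 h2)
          fun _ => (hold y h1).1
      have hcf := hTface c hc
      have hold' := hnc.1 c hc
      rw [Noncrossing, hmxeq] at hold'
      rw [Noncrossing, hmf]
      simp only at hold' ⊢
      by_cases hface : (mirror c.1).1.1 = (P.glue d₀).1
      · obtain ⟨k1, k2⟩ := key _ (.inl rfl) hface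
        obtain ⟨k3, k4⟩ := key _ (.inr rfl) (hcf ▸ hface)
        refine hold'.imp ?_ ?_
        · intro h0
          have : ∀ A A' b₁ B B' b₂ κ : ZMod 2, A + A' = κ → B + B' = κ →
            A + b₁ + (B + b₂) = 0 → A' + b₁ + (B' + b₂) = 0 := by decide
          exact this _ _ _ _ _ _ _ k1 k3 h0
        · intro h0
          have : ∀ A A' B B' b₁ b₂ κ : ZMod 2, A + A' = κ → B + B' = κ →
            A + B + (b₁ + b₂) = 0 → A' + B' + (b₁ + b₂) = 0 := by decide
          exact this _ _ _ _ _ _ _ k2 k4 h0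
      · left
        exact crossParity_eq_zero hgn_face hcf (κ := 0)
          (fun h0 => absurd (h0.trans (hgn_face.trans hbface.symm)) hface)
          fun h0 => absurd ((hcf.trans h0).trans (hgn_face.trans hbface.symm)) hface
    · intro c hc c' hc'
      obtain ⟨j, hj, rfl⟩ := List.mem_map.1 hc
      rw [List.mem_range] at hj
      rcases List.mem_cons.1 hc' with rfl | hc'
      · refine corner j hj _ hZface fun y hy => ?_
        rcases hZpt y hy with h1 | h1
        · exact .inl h1.1
        · exact .inr (.inl ⟨n, le_rfl, by omega, h1⟩)
      · exact corner j hj c' (hTface c' hc') fun y hy => .inl (hTpt' c' hc' y hy).1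
  · have hnd : ((List.range (n + 1)).map g).Nodup := by
      refine List.Nodup.map_on ?_ List.nodup_range
      intro i hi j hj hij
      rw [List.mem_range, Nat.lt_succ_iff] at hi hj
      exact hginj i hi j hj hij
    rw [D_row_eq_sum_single, crossingCochain, List.map_map]
    have : ((fun y : P.BoundaryPoint => Pi.single (M := fun _ => ZMod 2) (edge y.1) 1) ∘ f) =
        (fun d : P.Side => Pi.single (edge d) (1 : ZMod 2)) ∘ g := by
      funext j; simp [hf, edge_glue]
    rw [this, ← List.map_map, ← List.sum_toFinset _ hnd]
    refine Finset.sum_congr ?_ fun _ _ => rfl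
    ext d
    simp [hgmem]
  · intro d hd
    obtain ⟨j, hj, rfl⟩ := (hgmem d).1 hd
    refine ⟨ε, mem_points.2 (.inr ((hmemK _).2 ⟨j, hj, ?_⟩))⟩
    rw [← hmf, mirror_mirror]

end IsChordLoop

end PolygonGluing

namespace PolygonGluing

open BoundaryPoint

variable {P : PolygonGluing.{u}}

theorem crossingCochain_cons (y : P.BoundaryPoint) (L : List P.BoundaryPoint) :
    crossingCochain (y :: L) = Pi.single (edge y.1) 1 + crossingCochain L := by
  simp [crossingCochain]

theorem crossingCochain_append (L L' : List P.BoundaryPoint) :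
    crossingCochain (L ++ L') = crossingCochain L + crossingCochain L' := by
  simp [crossingCochain]

theorem crossingCochain_perm {L L' : List P.BoundaryPoint} (h : L.Perm L') :
    crossingCochain L = crossingCochain L' :=
  (h.map _).sum_eq

theorem crossingCochain_map_mirror (L : List P.BoundaryPoint) :
    crossingCochain (L.map mirror) = crossingCochain L := by
  simp [crossingCochain, Function.comp_def, mirror, edge_glue]

theorem mem_points_map_mirror {L : List P.BoundaryPoint} {y : P.BoundaryPoint} :
    y ∈ points (L.map mirror) ↔ y ∈ points L := by
  rw [points, List.map_map,
    show mirror ∘ mirror = (id : P.BoundaryPoint → _) from funext mirror_mirror, List.map_id,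
    List.perm_append_comm.mem_iff]
  rfl

namespace IsChordLoop

variable {x : P.BoundaryPoint} {l : List P.BoundaryPoint}

theorem exists_perm_of_mem (h : IsChordLoop x l) {y : P.BoundaryPoint} (hy : y ∈ x :: l) :
    ∃ l', IsChordLoop y l' ∧ (x :: l).Perm (y :: l') := by
  rcases List.mem_cons.1 hy with rfl | hy
  · exact ⟨l, h, List.Perm.refl _⟩
  · obtain ⟨l₁, l₂, rfl⟩ := List.append_of_mem hy
    exact ⟨_, h.rotate, List.perm_append_comm (l₁ := x :: l₁) (l₂ := y :: l₂)⟩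

/-- A loop can be started at any of its crossings, in any direction. -/
theorem exists_of_mem_points (h : IsChordLoop x l) {y : P.BoundaryPoint}
    (hy : y ∈ points (x :: l)) :
    ∃ l', IsChordLoop y l' ∧ crossingCochain (y :: l') = crossingCochain (x :: l) ∧
      ∀ z, z ∈ points (y :: l') ↔ z ∈ points (x :: l) := by
  rcases mem_points.1 hy with hy | hy
  · obtain ⟨l', h', hp⟩ := h.exists_perm_of_mem hy
    exact ⟨l', h', (crossingCochain_perm hp).symm, fun z => (points_perm hp).mem_iff.symm⟩
  · have hr : ((x :: l).map mirror).Perm (mirror x :: (l.map mirror).reverse) :=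
      List.Perm.cons _ (List.reverse_perm _).symm
    have hy' : y ∈ mirror x :: (l.map mirror).reverse :=
      hr.mem_iff.1 (List.mem_map.2 ⟨_, hy, mirror_mirror y⟩)
    obtain ⟨l', h', hp⟩ := h.reverse.exists_perm_of_mem hy'
    refine ⟨l', h', ?_, fun z => ?_⟩
    · rw [← crossingCochain_perm (hr.trans hp), crossingCochain_map_mirror]
    · rw [← (points_perm (hr.trans hp)).mem_iff, mem_points_map_mirror]

/-- Among the finitely many crossings of `d₀` the nearest to its start is taken as the base point,
where the detour is inserted. -/
theorem exists_encircle (h : IsChordLoop x l) {d₀ : P.Side} (hd : IsCrossed (x :: l) d₀) :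
    ∃ x' l', IsChordLoop x' l' ∧
      crossingCochain (x' :: l') = crossingCochain (x :: l) + P.D.row (tail d₀) ∧
      (∀ d, IsCrossed (x :: l) d → IsCrossed (x' :: l') d) ∧
      ∀ d, tail d = tail d₀ → IsCrossed (x' :: l') d := by
  classical
  obtain ⟨s, hs⟩ := hd
  obtain ⟨⟨d, p⟩, hy, hmin⟩ := ((points (x :: l)).toFinset.filter (·.1 = d₀)).exists_min_image
    Prod.snd ⟨(d₀, s), by simp [hs]⟩
  simp only [Finset.mem_filter, List.mem_toFinset] at hy hmin
  obtain ⟨hp, rfl⟩ := hy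
  obtain ⟨l', h', hco, hpt⟩ := h.exists_of_mem_points hp
  obtain ⟨K, hK, hKco, hKcr⟩ := h'.encircle_of_nearest fun s hs =>
    hmin (d, s) ⟨(hpt _).1 hs, rfl⟩
  have hsub : ∀ z, z ∈ points ((d, p) :: l') ∨ z ∈ points K → z ∈ points ((d, p) :: (K ++ l')) := by
    intro z
    simp only [mem_points, List.mem_cons, List.mem_append]
    tauto
  refine ⟨_, _, hK, ?_, ?_, ?_⟩
  · rw [← hco, ← hKco, crossingCochain_cons, crossingCochain_append, crossingCochain_cons]
    abel
  · rintro e ⟨t, ht⟩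
    exact ⟨t, hsub _ (.inl ((hpt _).2 ht))⟩
  · intro e he
    obtain ⟨t, ht⟩ := hKcr e he
    exact ⟨t, hsub _ (.inr ht)⟩

end IsChordLoop

end PolygonGluing

/-! ### Coboundaries as cochains of chord loops. -/

namespace PlanarPatch

open PolygonGluing BoundaryPoint

variable {P : PlanarPatch.{u}}

/-- Running twice around a vertex does not change the cochain of a loop. -/
theorem exists_isCrossed_of_reachable {x : P.BoundaryPoint} {l : List P.BoundaryPoint}
    (h : IsChordLoop x l) {d d' : P.Side} (hd : IsCrossed (x :: l) d)
    (hr : Relation.ReflTransGen (fun a b => b = P.glue a ∨ b = P.next a) d d') :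
    ∃ x' l', IsChordLoop x' l' ∧ crossingCochain (x' :: l') = crossingCochain (x :: l) ∧
      (∀ a, IsCrossed (x :: l) a → IsCrossed (x' :: l') a) ∧ IsCrossed (x' :: l') d' := by
  induction hr with
  | refl => exact ⟨x, l, h, rfl, fun _ => id, hd⟩
  | @tail b e _ hbe ih =>
    obtain ⟨x₁, l₁, h₁, hco₁, hsub₁, hb⟩ := ih
    rcases hbe with rfl | rfl
    · exact ⟨x₁, l₁, h₁, hco₁, hsub₁, hb.glue⟩
    -- `next b` starts where `glue b` starts, and `glue b` is crossed; two detours around that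
    -- vertex cross `next b` and cancel in the cochain.
    · obtain ⟨x₂, l₂, h₂, hco₂, hsub₂, -⟩ := h₁.exists_encircle hb.glue
      obtain ⟨x₃, l₃, h₃, hco₃, hsub₃, hv⟩ := h₂.exists_encircle (hsub₂ _ hb.glue)
      refine ⟨x₃, l₃, h₃, ?_, fun a ha => hsub₃ a (hsub₂ a (hsub₁ a ha)), hv _ (tail_next b)⟩
      rw [hco₃, hco₂, hco₁, add_assoc]
      ext e
      simp [CharTwo.add_self_eq_zero]

/-- A loop that meets every edge can be led around any vertex, so this is the neutral starting point
for building coboundaries. -/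
theorem exists_isChordLoop_isCrossed (P : PlanarPatch.{u}) :
    ∃ (x : P.BoundaryPoint) (l : List P.BoundaryPoint), IsChordLoop x l ∧
      crossingCochain (x :: l) = 0 ∧ ∀ d, IsCrossed (x :: l) d := by
  classical
  let d₀ : P.Side := ⟨P.outer, 0, P.deg_pos _⟩
  suffices ∀ S : Finset P.Side, ∃ (x : P.BoundaryPoint) (l : List P.BoundaryPoint),
      IsChordLoop x l ∧ crossingCochain (x :: l) = 0 ∧ IsCrossed (x :: l) d₀ ∧
        ∀ d ∈ S, IsCrossed (x :: l) d by
    obtain ⟨x, l, h, hco, -, hS⟩ := this Finset.univ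
    exact ⟨x, l, h, hco, fun d => hS d (Finset.mem_univ d)⟩
  intro S
  induction S using Finset.induction_on with
  | empty =>
    refine ⟨_, _, IsChordLoop.bigon d₀, ?_, ⟨1 / 3, mem_points.2 (.inl List.mem_cons_self)⟩,
      by simp⟩
    ext e
    simp [crossingCochain, edge_glue, CharTwo.add_self_eq_zero]
  | insert d S _ ih =>
    obtain ⟨x, l, h, hco, h0, hS⟩ := ih
    obtain ⟨x', l', h', hco', hsub, hd⟩ := exists_isCrossed_of_reachable h h0 (P.connected d₀ d)
    refine ⟨x', l', h', hco'.trans hco, hsub _ h0, fun a ha => ?_⟩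
    rcases Finset.mem_insert.1 ha with rfl | ha
    · exact hd
    · exact hsub a (hS a ha)

/-- Every coboundary is the cochain of a chord loop. -/
theorem exists_isChordLoop_vecMul_D (y : P.Vertex → ZMod 2) :
    ∃ (x : P.BoundaryPoint) (l : List P.BoundaryPoint), IsChordLoop x l ∧
      crossingCochain (x :: l) = Matrix.vecMul y P.D := by
  have key : ∀ S : Finset P.Vertex, ∃ (x : P.BoundaryPoint) (l : List P.BoundaryPoint),
      IsChordLoop x l ∧ crossingCochain (x :: l) = ∑ v ∈ S, P.D.row v ∧ ∀ d, IsCrossed (x :: l) d := by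
    intro S
    induction S using Finset.induction_on with
    | empty => simpa using exists_isChordLoop_isCrossed P
    | insert v S hv ih =>
      obtain ⟨x, l, h, hco, hall⟩ := ih
      obtain ⟨d, rfl⟩ := tail_surjective v
      obtain ⟨x', l', h', hco', hsub, -⟩ := h.exists_encircle (hall d)
      exact ⟨x', l', h', by rw [hco', hco, Finset.sum_insert hv, add_comm],
        fun a => hsub a (hall a)⟩
  obtain ⟨x, l, h, hco, -⟩ := key (Finset.univ.filter fun v => y v = 1)
  refine ⟨x, l, h, hco.trans ?_⟩
  have h01 : ∀ s : ZMod 2, s ≠ 1 → s = 0 := by decide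
  ext e
  rw [Finset.sum_apply, Finset.sum_filter, Matrix.vecMul, dotProduct]
  refine Finset.sum_congr rfl fun v _ => ?_
  split_ifs with hv
  · rw [hv, one_mul, Matrix.row]
  · rw [h01 _ hv, zero_mul]

end PlanarPatch

/-- The point of the unit circle at a given angle. -/
noncomputable def unitCirclePoint (θ : ℝ) : ℂ := Complex.exp (θ * Complex.I)

/-! ### Chords of the unit circle. -/

namespace unitCirclePoint

open Real

theorem re_eq (θ : ℝ) : (unitCirclePoint θ).re = cos θ := Complex.exp_ofReal_mul_I_re θ

theorem im_eq (θ : ℝ) : (unitCirclePoint θ).im = sin θ := Complex.exp_ofReal_mul_I_im θ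

theorem norm_eq (θ : ℝ) : ‖unitCirclePoint θ‖ = 1 := Complex.norm_exp_ofReal_mul_I θ

theorem sin_half_sub_pos {α β : ℝ} (hα : 0 < α) (hβ : β < 2 * π) (h : α < β) :
    0 < sin ((β - α) / 2) :=
  sin_pos_of_pos_of_lt_pi (by linarith) (by linarith)

theorem sin_half_sub_neg {α β : ℝ} (hβ : 0 < β) (hα : α < 2 * π) (h : β < α) :
    sin ((β - α) / 2) < 0 :=
  sin_neg_of_neg_of_neg_pi_lt (by linarith) (by linarith)

theorem sin_half_sub_ne_zero {α β : ℝ} (hα : α ∈ Set.Ioo 0 (2 * π)) (hβ : β ∈ Set.Ioo 0 (2 * π))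
    (h : α ≠ β) : sin ((β - α) / 2) ≠ 0 := by
  rcases lt_or_gt_of_ne h with h | h
  · exact (sin_half_sub_pos hα.1 hβ.2 h).ne'
  · exact (sin_half_sub_neg hβ.1 hα.2 h).ne

theorem ne_of_ne {α β : ℝ} (hα : α ∈ Set.Ioo 0 (2 * π)) (hβ : β ∈ Set.Ioo 0 (2 * π))
    (h : α ≠ β) : unitCirclePoint α ≠ unitCirclePoint β := by
  intro heq
  have hs := sin_half_sub_ne_zero hα hβ h
  have h1 := congrArg Complex.re heq
  have h2 := congrArg Complex.im heq
  rw [re_eq, re_eq] at h1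
  rw [im_eq, im_eq] at h2
  have h3 := cos_sub_cos β α
  have h4 := sin_sub_sin β α
  rw [h1, sub_self] at h3
  rw [h2, sub_self] at h4
  have h5 : sin ((β + α) / 2) = 0 := by
    by_contra h
    exact mul_ne_zero (mul_ne_zero (by norm_num) h) hs h3.symm
  have h6 : cos ((β + α) / 2) = 0 := by
    by_contra h
    exact mul_ne_zero (mul_ne_zero (by norm_num) hs) h h4.symm
  have := sin_sq_add_cos_sq ((β + α) / 2)
  rw [h5, h6] at this
  norm_num at this

/-- Twice the signed area of the triangle with corners `a`, `b`, `z`. -/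
def signedArea (a b z : ℂ) : ℝ := (b.re - a.re) * (z.im - a.im) - (b.im - a.im) * (z.re - a.re)

/-- Half differences of angles in `(0, 2π)` lie in `(-π, π)`, so the sign of each sine is given by
the order of the angles: the area decides on which arc `γ` lies. -/
theorem signedArea_eq (α β γ : ℝ) :
    signedArea (unitCirclePoint α) (unitCirclePoint β) (unitCirclePoint γ) =
      4 * sin ((β - α) / 2) * (sin ((γ - α) / 2) * sin ((γ - β) / 2)) := by
  have : sin ((γ - β) / 2) = sin ((γ + α) / 2 - (β + α) / 2) := by congr 1; ring
  rw [signedArea, re_eq, re_eq, re_eq, im_eq, im_eq, im_eq, cos_sub_cos β, sin_sub_sin γ,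
    sin_sub_sin β, cos_sub_cos γ, this, sin_sub]
  ring

theorem signedArea_combo (a b z w : ℂ) (t : ℝ) :
    signedArea a b (AffineMap.lineMap z w t) = (1 - t) * signedArea a b z + t * signedArea a b w := by
  simp only [signedArea, AffineMap.lineMap_apply_module, Complex.add_re, Complex.add_im,
    Complex.real_smul, Complex.mul_re, Complex.mul_im, Complex.ofReal_re, Complex.ofReal_im]
  ring

theorem sin_mul_sin_pos {α β γ : ℝ} (hα : α ∈ Set.Ioo 0 (2 * π)) (hβ : β ∈ Set.Ioo 0 (2 * π))
    (hγ : γ ∈ Set.Ioo 0 (2 * π)) (h1 : γ ≠ α) (h2 : γ ≠ β) (h : α < γ ↔ β < γ) :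
    0 < sin ((γ - α) / 2) * sin ((γ - β) / 2) := by
  rcases lt_or_gt_of_ne h1 with h3 | h3
  · have h4 : γ < β := lt_of_le_of_ne (not_lt.1 fun h' => h3.not_gt (h.2 h')) h2
    exact mul_pos_of_neg_of_neg (sin_half_sub_neg hγ.1 hα.2 h3) (sin_half_sub_neg hγ.1 hβ.2 h4)
  · exact mul_pos (sin_half_sub_pos hα.1 hγ.2 h3) (sin_half_sub_pos hβ.1 hγ.2 (h.1 h3))

theorem sin_mul_sin_neg {α β γ : ℝ} (hα : α ∈ Set.Ioo 0 (2 * π)) (hβ : β ∈ Set.Ioo 0 (2 * π))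
    (hγ : γ ∈ Set.Ioo 0 (2 * π)) (h1 : γ ≠ α) (h2 : γ ≠ β) (h : ¬ (α < γ ↔ β < γ)) :
    sin ((γ - α) / 2) * sin ((γ - β) / 2) < 0 := by
  rcases lt_or_gt_of_ne h1 with h3 | h3
  · have h4 : β < γ := by
      by_contra h'
      exact h (iff_of_false h3.not_gt h')
    exact mul_neg_of_neg_of_pos (sin_half_sub_neg hγ.1 hα.2 h3) (sin_half_sub_pos hβ.1 hγ.2 h4)
  · have h4 : γ < β := lt_of_le_of_ne (not_lt.1 fun h' => h (iff_of_true h3 h')) h2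
    exact mul_neg_of_pos_of_neg (sin_half_sub_pos hα.1 hγ.2 h3) (sin_half_sub_neg hγ.1 hβ.2 h4)

/-- Two chords of the unit circle are disjoint if their ends do not interlace. -/
theorem lineMap_ne_lineMap {α β γ δ : ℝ} (hα : α ∈ Set.Ioo 0 (2 * π)) (hβ : β ∈ Set.Ioo 0 (2 * π))
    (hγ : γ ∈ Set.Ioo 0 (2 * π)) (hδ : δ ∈ Set.Ioo 0 (2 * π)) (hαβ : α ≠ β)
    (hγα : γ ≠ α) (hγβ : γ ≠ β) (hδα : δ ≠ α) (hδβ : δ ≠ β)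
    (h : (α < γ ↔ β < γ) ↔ (α < δ ↔ β < δ)) {s t : ℝ} (ht0 : 0 ≤ t) (ht1 : t ≤ 1) :
    (AffineMap.lineMap (unitCirclePoint α) (unitCirclePoint β) s : ℂ) ≠
      AffineMap.lineMap (unitCirclePoint γ) (unitCirclePoint δ) t := by
  intro heq
  have h0 := congrArg (signedArea (unitCirclePoint α) (unitCirclePoint β)) heq
  rw [signedArea_combo, signedArea_combo, signedArea_eq, signedArea_eq, signedArea_eq,
    signedArea_eq] at h0
  -- A common point lies on the line through the first two points and has area zero; but its area is
  -- a convex combination of two numbers of the same sign.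
  simp only [sub_self, zero_div, sin_zero, zero_mul, mul_zero, add_zero] at h0
  have hs := sin_half_sub_ne_zero hα hβ hαβ
  set S := sin ((β - α) / 2)
  set p := sin ((γ - α) / 2) * sin ((γ - β) / 2) with hp
  set q := sin ((δ - α) / 2) * sin ((δ - β) / 2) with hq
  have h1 : (1 - t) * p + t * q = 0 := by
    have : (4 * S) * ((1 - t) * p + t * q) = 0 := by linarith
    exact (mul_eq_zero.1 this).resolve_left (by simpa using hs)
  by_cases hc : (α < γ ↔ β < γ)
  · have hp0 := sin_mul_sin_pos hα hβ hγ hγα hγβ hc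
    have hq0 := sin_mul_sin_pos hα hβ hδ hδα hδβ (h.1 hc)
    rw [← hp] at hp0
    rw [← hq] at hq0
    rcases ht0.eq_or_lt with rfl | ht
    · linarith
    · nlinarith [mul_pos ht hq0, mul_nonneg (sub_nonneg.2 ht1) hp0.le]
  · have hp0 := sin_mul_sin_neg hα hβ hγ hγα hγβ hc
    have hq0 := sin_mul_sin_neg hα hβ hδ hδα hδβ fun h' => hc (h.2 h')
    rw [← hp] at hp0
    rw [← hq] at hq0
    rcases ht0.eq_or_lt with rfl | ht
    · linarith
    · nlinarith [mul_neg_of_pos_of_neg ht hq0, mul_nonneg (sub_nonneg.2 ht1) (neg_pos.2 hp0).le]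

end unitCirclePoint

theorem List.links_eq_zip {α : Type*} (x : α) (l : List α) (z : α) :
    links x l z = (x :: l).zip (l ++ [z]) := by
  induction l generalizing x with
  | nil => rfl
  | cons y l ih => rw [links, ih, cons_append, zip_cons_cons]

namespace PolygonGluing

open BoundaryPoint

variable {P : PolygonGluing.{u}}

namespace BoundaryPoint

/-- The point on the unit circle. -/
noncomputable def toComplex (x : P.BoundaryPoint) : ℂ := sidePoint x.1 x.2

noncomputable def theta (x : P.BoundaryPoint) : ℝ := 2 * Real.pi / (P.deg x.1.1 : ℝ) * angle x

theorem toComplex_eq (x : P.BoundaryPoint) : toComplex x = unitCirclePoint (theta x) := by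
  rw [toComplex, sidePoint, unitCirclePoint, theta, angle]
  congr 1
  push_cast
  ring

theorem two_pi_div_deg_pos (f : P.Face) : 0 < 2 * Real.pi / (P.deg f : ℝ) :=
  div_pos Real.two_pi_pos (by exact_mod_cast P.deg_pos f)

theorem theta_mem {x : P.BoundaryPoint} (hx : x.2 ∈ Set.Ioo (0 : ℝ) 1) :
    theta x ∈ Set.Ioo 0 (2 * Real.pi) := by
  have h0 := two_pi_div_deg_pos x.1.1
  have hd : (0 : ℝ) < P.deg x.1.1 := by exact_mod_cast P.deg_pos x.1.1
  have h1 : ((x.1.2 : ℕ) : ℝ) + 1 ≤ P.deg x.1.1 := by exact_mod_cast x.1.2.2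
  have h2 : (0 : ℝ) ≤ ((x.1.2 : ℕ) : ℝ) := Nat.cast_nonneg _
  have h3 : 0 < angle x := by rw [angle]; linarith [hx.1]
  have h4 : angle x < P.deg x.1.1 := by rw [angle]; linarith [hx.2]
  refine ⟨mul_pos h0 h3, ?_⟩
  calc theta x < 2 * Real.pi / (P.deg x.1.1 : ℝ) * P.deg x.1.1 := mul_lt_mul_of_pos_left h4 h0
    _ = 2 * Real.pi := div_mul_cancel₀ _ hd.ne'

theorem theta_lt_iff {x y : P.BoundaryPoint} (h : x.1.1 = y.1.1) :
    theta x < theta y ↔ angle x < angle y := by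
  rw [theta, theta, h]
  exact mul_lt_mul_iff_right₀ (two_pi_div_deg_pos _)

theorem eq_of_theta_eq {x y : P.BoundaryPoint} (hx : x.2 ∈ Set.Ioo (0 : ℝ) 1)
    (hy : y.2 ∈ Set.Ioo (0 : ℝ) 1) (h : x.1.1 = y.1.1) (ht : theta x = theta y) : x = y := by
  have ha : angle x = angle y := by
    rw [theta, theta, h] at ht
    exact mul_left_cancel₀ (two_pi_div_deg_pos _).ne' ht
  obtain ⟨⟨f, i⟩, s⟩ := x
  obtain ⟨⟨f', j⟩, t⟩ := y
  obtain rfl : f = f' := h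
  simp only [angle, Set.mem_Ioo] at ha hx hy
  have hij : (i : ℕ) = j := by
    apply le_antisymm
    · have : ((i : ℕ) : ℝ) < (j : ℕ) + 1 := by linarith
      exact Nat.lt_succ_iff.1 (by exact_mod_cast this)
    · have : ((j : ℕ) : ℝ) < (i : ℕ) + 1 := by linarith
      exact Nat.lt_succ_iff.1 (by exact_mod_cast this)
  obtain rfl : i = j := Fin.ext hij
  rw [add_right_inj] at ha
  rw [ha]

theorem lineMap_ne_of_crossParity_eq_zero {a b c d : P.BoundaryPoint}
    (ha : a.2 ∈ Set.Ioo (0 : ℝ) 1) (hb : b.2 ∈ Set.Ioo (0 : ℝ) 1)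
    (hc : c.2 ∈ Set.Ioo (0 : ℝ) 1) (hd : d.2 ∈ Set.Ioo (0 : ℝ) 1)
    (hab : a.1.1 = b.1.1) (hca : c.1.1 = a.1.1) (hda : d.1.1 = a.1.1)
    (nab : a ≠ b) (nca : c ≠ a) (ncb : c ≠ b) (nda : d ≠ a) (ndb : d ≠ b)
    (h : crossParity a b c d = 0) {s t : ℝ} (ht0 : 0 ≤ t) (ht1 : t ≤ 1) :
    (AffineMap.lineMap (toComplex a) (toComplex b) s : ℂ) ≠
      AffineMap.lineMap (toComplex c) (toComplex d) t := by
  have hcb := hca.trans hab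
  have hdb := hda.trans hab
  simp only [toComplex_eq]
  refine unitCirclePoint.lineMap_ne_lineMap (theta_mem ha) (theta_mem hb) (theta_mem hc)
    (theta_mem hd) (fun h => nab (eq_of_theta_eq ha hb hab h))
    (fun h => nca (eq_of_theta_eq hc ha hca h)) (fun h => ncb (eq_of_theta_eq hc hb hcb h))
    (fun h => nda (eq_of_theta_eq hd ha hda h)) (fun h => ndb (eq_of_theta_eq hd hb hdb h))
    ?_ ht0 ht1
  rw [theta_lt_iff hca.symm, theta_lt_iff hcb.symm, theta_lt_iff hda.symm, theta_lt_iff hdb.symm]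
  simp only [crossParity, prec, and_iff_right hca.symm, and_iff_right hcb.symm,
    and_iff_right hda.symm, and_iff_right hdb.symm] at h
  have h2 : (1 : ZMod 2) + 1 = 0 := by decide
  by_cases p₁ : angle a < angle c <;> by_cases p₂ : angle b < angle c <;>
    by_cases p₃ : angle a < angle d <;> by_cases p₄ : angle b < angle d <;>
    simp only [p₁, p₂, p₃, p₄, if_true, if_false, add_zero, zero_add, h2, one_ne_zero,
      iff_false, false_iff, not_true_eq_false] at h ⊢

end BoundaryPoint

end PolygonGluing

/-! ### Realisation by straight chords. -/

namespace PlanarPatch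

open PolygonGluing BoundaryPoint

variable {P : PlanarPatch.{u}}

/-- A chord loop, with its chords drawn as straight segments, is a simple closed dual loop. -/
theorem exists_simpleDualLoop_of_isChordLoop {x : P.BoundaryPoint} {l : List P.BoundaryPoint}
    (h : IsChordLoop x l) : ∃ w : SimpleDualLoop P, w.cochain = crossingCochain (x :: l) := by
  classical
  set y : Fin (l.length + 1) → P.BoundaryPoint := fun i => (x :: l)[(i : ℕ)] with hy
  have hlen : (List.links x l x).length = l.length + 1 := by
    rw [List.links_eq_zip]; simp
  have hlinks : ∀ i : Fin (l.length + 1),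
      (List.links x l x)[(i : ℕ)]'(by rw [hlen]; exact i.2) = (y i, y (i + 1)) := by
    intro i
    simp only [List.links_eq_zip, List.getElem_zip, hy]
    congr 1
    rcases Fin.eq_castSucc_or_eq_last i with ⟨j, rfl⟩ | rfl
    · simp
    · simp
  have hmem : ∀ i, y i ∈ x :: l := fun i => List.getElem_mem _
  have hpos : ∀ i, (y i).2 ∈ Set.Ioo (0 : ℝ) 1 := fun i => h.pos_mem _ (hmem i)
  have hmpos : ∀ i, (mirror (y i)).2 ∈ Set.Ioo (0 : ℝ) 1 := fun i =>
    points_pos_mem h.pos_mem _ (mirror_mem_points.2 (mem_points.2 (.inl (hmem i))))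
  have hface : ∀ i, (mirror (y i)).1.1 = (y (i + 1)).1.1 := fun i =>
    h.same_face (y i, y (i + 1)) (hlinks i ▸ List.getElem_mem _)
  have hnd := h.nodup
  rw [points, List.nodup_append] at hnd
  obtain ⟨hnd, -, hdis⟩ := hnd
  have hinj : Function.Injective y := fun i j hij =>
    Fin.ext ((hnd.getElem_inj_iff).1 hij)
  have hmy : ∀ i j, mirror (y i) ≠ y j := fun i j hij =>
    hdis _ (hmem j) _ (List.mem_map_of_mem (hmem i)) hij.symm
  have hnc : ∀ i j, i ≠ j → Noncrossing (y i, y (i + 1)) (y j, y (j + 1)) := by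
    have key : ∀ i j : Fin (l.length + 1), i < j →
        Noncrossing (y i, y (i + 1)) (y j, y (j + 1)) := fun i j hij => by
      have := List.pairwise_iff_getElem.1 h.noncrossing i j (by rw [hlen]; exact i.2)
        (by rw [hlen]; exact j.2) hij
      rwa [hlinks, hlinks] at this
    intro i j hij
    rcases lt_or_gt_of_ne hij with h | h
    · exact key i j h
    · exact (key j i h).symm
  have hsep : ∀ i j, i ≠ j → (mirror (y i)).1.1 = (mirror (y j)).1.1 →
      crossParity (mirror (y i)) (y (i + 1)) (mirror (y j)) (y (j + 1)) = 0 →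
      ∀ s t : ℝ, 0 ≤ t → t ≤ 1 →
      (AffineMap.lineMap (toComplex (mirror (y i))) (toComplex (y (i + 1))) s : ℂ) ≠
        AffineMap.lineMap (toComplex (mirror (y j))) (toComplex (y (j + 1))) t := by
    intro i j hij hf hc s t ht0 ht1
    exact lineMap_ne_of_crossParity_eq_zero (hmpos i) (hpos _) (hmpos j) (hpos _) (hface i)
      hf.symm ((hface j).symm.trans hf.symm) (hmy _ _) (mirror_injective.ne (hinj.ne hij.symm))
      (hmy _ _) (hmy _ _).symm (hinj.ne fun h' => hij (add_right_cancel h').symm) hc ht0 ht1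
  have hends : ∀ i, toComplex (mirror (y i)) ≠ toComplex (y (i + 1)) := fun i => by
    rw [toComplex_eq, toComplex_eq]
    exact unitCirclePoint.ne_of_ne (theta_mem (hmpos i)) (theta_mem (hpos _))
      fun h' => hmy _ _ (eq_of_theta_eq (hmpos i) (hpos _) (hface i) h')
  refine ⟨{ m := l.length
            side := fun i => (y i).1
            pos := fun i => (y i).2
            pos_mem := hpos
            same_face := hface
            arc := fun i => ⟨fun t => AffineMap.lineMap (toComplex (mirror (y i)))
              (toComplex (y (i + 1))) (t : ℝ), by
                simp only [AffineMap.lineMap_apply_module]; fun_prop⟩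
            arc_zero := fun i => by
              simp only [ContinuousMap.coe_mk, Set.Icc.coe_zero, AffineMap.lineMap_apply_zero]
              rfl
            arc_one := fun i => by
              simp only [ContinuousMap.coe_mk, Set.Icc.coe_one, AffineMap.lineMap_apply_one]
              rfl
            arc_interior := ?_
            arc_injective := ?_
            arc_disjoint := ?_ }, ?_⟩
  · intro i t ht0 ht1
    have h0 : (0 : ℝ) < t := lt_of_le_of_ne t.2.1 fun h' => ht0 (Subtype.ext h'.symm)
    have h1 : (t : ℝ) < 1 := lt_of_le_of_ne t.2.2 fun h' => ht1 (Subtype.ext h')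
    simp only [ContinuousMap.coe_mk, AffineMap.lineMap_apply_module]
    -- Strict convexity of the disk keeps the inner points of a chord off the circle.
    refine norm_combo_lt_of_ne ?_ ?_ (hends i) (by linarith) h0 (by ring)
    · rw [toComplex_eq, unitCirclePoint.norm_eq]
    · rw [toComplex_eq, unitCirclePoint.norm_eq]
  · intro i s t hst
    exact Subtype.ext (AffineMap.lineMap_injective ℝ (hends i) hst)
  · intro i j hij hf
    rw [Set.disjoint_left]
    rintro _ ⟨s, rfl⟩ ⟨t, hst⟩
    simp only [ContinuousMap.coe_mk] at hst
    rcases hnc i j hij with hc | hc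
    · exact hsep i j hij hf hc s t t.2.1 t.2.2 hst.symm
    · exact hsep j i hij.symm hf.symm hc t s s.2.1 s.2.2 hst
  · ext e
    rw [crossingCochain, ← Fin.sum_univ_fun_getElem, Finset.sum_apply, SimpleDualLoop.cochain,
      Set.ncard_eq_toFinset_card']
    simp only [Pi.single_apply, Finset.sum_boole]
    congr 2
    ext i
    simp [hy, eq_comm]

end PlanarPatch

/-! ### The equivalences. -/

theorem theorem1 (P : PlanarPatch.{u}) {ι : Type*} (c : ι → PlanarPatch.PrimalPath P)
    (hdisj : Pairwise fun a b => Disjoint (c a).support (c b).support) :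
    List.TFAE [
      (PlanarPatch.endpointGraph c).Bipartite,
      ∀ k, (PlanarPatch.endpointGraph c).HasCycle k → Even (k + 1),
      ¬ ∃ A : Finset ι, Odd A.card ∧ Matrix.mulVec P.D (∑ a ∈ A, (c a).chain) = 0,
      ∃ w : PlanarPatch.SimpleDualLoop P, ∀ a, dotProduct w.cochain (c a).chain = 1,
      ∃ w : P.Edge → ZMod 2, Matrix.mulVec P.B.transpose w = 0 ∧
        ∀ a, dotProduct w (c a).chain = 1] := by
  have := PlanarPatch.finite_of_pairwise_disjoint hdisj
  tfae_have 1 → 2 := fun h _ hk => h.even_of_hasCycle hk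
  tfae_have 2 → 1 := Graph.bipartite_of_forall_hasCycle_even
  tfae_have 1 → 4 := fun h => by
    obtain ⟨x, hx⟩ := PlanarPatch.exists_potential_of_bipartite h
    obtain ⟨y, l, hl, hco⟩ := PlanarPatch.exists_isChordLoop_vecMul_D x
    obtain ⟨w, hw⟩ := PlanarPatch.exists_simpleDualLoop_of_isChordLoop hl
    exact ⟨w, fun a => by rw [hw, hco, (c a).vecMul_D_dotProduct_chain, hx a]⟩
  tfae_have 4 → 5 := fun ⟨w, hw⟩ => ⟨w.cochain, w.mulVec_transpose_B_cochain, hw⟩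
  tfae_have 5 → 3 := fun ⟨_, hw, hc⟩ => PlanarPatch.not_exists_odd_of_cocycle hw hc
  tfae_have 3 → 1 := fun h => by
    obtain ⟨x, hx⟩ := PlanarPatch.exists_potential_of_not_exists_odd h
    exact PlanarPatch.bipartite_of_potential hx
  tfae_finish
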